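/- Let $k\in\{-1,0,1\}$ and let $M_k$ be hyperbolic space $\mathbb H^3$, Euclidean space $\mathbb R^3$ or the sphere $S^3$, with its metric $d\sigma^2$ of constant curvature $k$. Let $I\subset\mathbb R$ be a nonempty open interval and $a:I\to(0,\infty)$ a function of class $C^2$, and consider the FRW universe $I\times M_k$ with metric $g=-dt^2+a^2(t)\,d\sigma^2$ (it is globally hyperbolic, because its slices are complete). Assume that it is regularly hyperbolic: the metrics $a^2(t)\,d\sigma^2$, $t\in I$, are uniformly bounded below by a positive multiple of one of them (the lapse is $1$ and the shift is $0$). Let $\mu(t)$ and $p(t)$ be the density and the pressure of a comoving perfect fluid satisfying Einstein's equations $G_{ij}=\kappa T_{ij}$, $T_{ij}=(\mu+p)u_iu_j+p\,g_{ij}$, $u=\partial_t$, $\kappa>0$. Let $E_{ij}=R^0{}_{i0j}$ and $D_{ij}=\frac14\eta_{ihk}\eta_{jlm}R^{hklm}$, where $\eta$ is the volume element of the slices, and let $|X|^2=g^{ij}g^{kl}X_{ik}X_{jl}$ be the spatial norm. Suppose that the universe is null or timelike geodesically incomplete to the future (respectively, to the past); in particular, this covers the case that it is both. Then $t_s=\sup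 I$ (respectively, $t_s=\inf I$) is finite and, as $t\to t_s$ in $I$, one of the following behaviours occurs at every point of the slices: * $B_1$: $|E|\to\infty$ and $|D|\to\infty$; * $B_2$: $|E|<\infty$ and $|D|\to\infty$; * $B_3$: $|E|\to\infty$ and $|D|<\infty$; * $B_4$: $|E|<\infty$ and $|D|<\infty$. Moreover * $B_1\Leftrightarrow$ $\mu\to\infty$ and $|\mu+3p|\to\infty$; * $B_2\Leftrightarrow$ $\mu\to\infty$ and $|\mu+3p|<\infty$; * $B_3\Leftrightarrow$ $\mu<\infty$ and $|\mu+3p|\to\infty$ $\Leftrightarrow$ $\mu<\infty$ and $|p|\to\infty$; * $B_4\Leftrightarrow$ $\mu<\infty$ and $|\mu+3p|<\infty$ $\Leftrightarrow$ $\mu<\infty$ and $|p|<\infty$. Here $f<\infty$ means that $f$ is bounded above on $I$ near $t_s$, and $f\to\infty$ means that it is not. If $|E|$ and $|D|$ have (finite or infinite) limits as $t\to t_s$, then one of $B_1$–$B_4$ also occurs with $f\to\infty$ read as $\lim_{t\to t_s}f(t)=\infty$. The equivalences hold in both readings of $f\to\infty$, whether or not these limits exist. -/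

import Mathlib

open Filter Topology

noncomputable section

namespace FRW

/-! ### Pseudo-Riemannian geometry of a metric given in coordinates on `ℝ⁴` -/

/-- Partial derivative of `f` with respect to the `i`-th coordinate. -/
def pd (i : Fin 4) (f : (Fin 4 → ℝ) → ℝ) (x : Fin 4 → ℝ) : ℝ :=
  deriv (fun s => f (Function.update x i s)) (x i)

/-- Christoffel symbols `Γ^i_{jk}` of the Levi-Civita connection of `g`. -/
def christoffel (g : (Fin 4 → ℝ) → Matrix (Fin 4) (Fin 4) ℝ) (i j k : Fin 4)
    (x : Fin 4 → ℝ) : ℝ :=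
  (1 / 2) * ∑ l, (g x)⁻¹ i l *
    (pd j (fun y => g y l k) x + pd k (fun y => g y l j) x - pd l (fun y => g y j k) x)

/-- Riemann tensor `R^i_{jkl} = ∂_k Γ^i_{lj} - ∂_l Γ^i_{kj} + Γ^i_{km} Γ^m_{lj} - Γ^i_{lm} Γ^m_{kj}`. -/
def riemann (g : (Fin 4 → ℝ) → Matrix (Fin 4) (Fin 4) ℝ) (i j k l : Fin 4)
    (x : Fin 4 → ℝ) : ℝ :=
  pd k (christoffel g i l j) x - pd l (christoffel g i k j) x
    + ∑ m, (christoffel g i k m x * christoffel g m l j x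
      - christoffel g i l m x * christoffel g m k j x)

/-- Ricci tensor `R_{jl} = R^i_{jil}`. -/
def ricci (g : (Fin 4 → ℝ) → Matrix (Fin 4) (Fin 4) ℝ) (j l : Fin 4) (x : Fin 4 → ℝ) : ℝ :=
  ∑ i, riemann g i j i l x

/-- Scalar curvature `g^{jl} R_{jl}`. -/
def scalarCurvature (g : (Fin 4 → ℝ) → Matrix (Fin 4) (Fin 4) ℝ) (x : Fin 4 → ℝ) : ℝ :=
  ∑ j, ∑ l, (g x)⁻¹ j l * ricci g j l x

/-- Einstein tensor `G_{jl} = R_{jl} - (1/2) R g_{jl}`. -/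
def einstein (g : (Fin 4 → ℝ) → Matrix (Fin 4) (Fin 4) ℝ) (j l : Fin 4) (x : Fin 4 → ℝ) : ℝ :=
  ricci g j l x - (1 / 2) * scalarCurvature g x * g x j l

/-- Riemann tensor with all indices raised, `R^{hklm}`. -/
def riemannUp (g : (Fin 4 → ℝ) → Matrix (Fin 4) (Fin 4) ℝ) (h k l m : Fin 4)
    (x : Fin 4 → ℝ) : ℝ :=
  ∑ k', ∑ l', ∑ m', (g x)⁻¹ k k' * (g x)⁻¹ l l' * (g x)⁻¹ m m' * riemann g h k' l' m' x

/-- The square `g_x(v, v)`. -/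
def normSq (g : (Fin 4 → ℝ) → Matrix (Fin 4) (Fin 4) ℝ) (x v : Fin 4 → ℝ) : ℝ :=
  ∑ i, ∑ j, g x i j * v i * v j

/-- The (affinely parametrised) geodesic equation for the coordinate curve `c` at parameter `s`. -/
def GeodesicEqAt (g : (Fin 4 → ℝ) → Matrix (Fin 4) (Fin 4) ℝ) (c : ℝ → Fin 4 → ℝ)
    (s : ℝ) : Prop :=
  (∀ᶠ r in 𝓝 s, DifferentiableAt ℝ c r) ∧
  ∀ i, HasDerivAt (fun r => deriv c r i)
    (-∑ j, ∑ k, christoffel g i j k (c s) * deriv c s j * deriv c s k) s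

/-! ### The `3 + 1` splitting: coordinate `0` is time, coordinates `1, 2, 3` are spatial -/

/-- The induced metric on the slices of constant time. -/
def spatialMetric (g : (Fin 4 → ℝ) → Matrix (Fin 4) (Fin 4) ℝ) (x : Fin 4 → ℝ) :
    Matrix (Fin 3) (Fin 3) ℝ :=
  fun i j => g x i.succ j.succ

/-- The alternating symbol `ε_{ijk}`. -/
def leviCivita (i j k : Fin 3) : ℝ :=
  ((1 : Matrix (Fin 3) (Fin 3) ℝ).submatrix ![i, j, k] id).det

/-- Volume element `η_{ijk}` of the spatial metric. -/
def eta (g : (Fin 4 → ℝ) → Matrix (Fin 4) (Fin 4) ℝ) (x : Fin 4 → ℝ) (i j k : Fin 3) : ℝ :=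
  √(spatialMetric g x).det * leviCivita i j k

/-- Electric tensor `E_{ij} = R^0_{i0j}`. -/
def electricE (g : (Fin 4 → ℝ) → Matrix (Fin 4) (Fin 4) ℝ) (x : Fin 4 → ℝ) :
    Matrix (Fin 3) (Fin 3) ℝ :=
  fun i j => riemann g 0 i.succ 0 j.succ x

/-- Electric tensor `D_{ij} = (1/4) η_{ihk} η_{jlm} R^{hklm}`. -/
def electricD (g : (Fin 4 → ℝ) → Matrix (Fin 4) (Fin 4) ℝ) (x : Fin 4 → ℝ) :
    Matrix (Fin 3) (Fin 3) ℝ :=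
  fun i j => (1 / 4) * ∑ h, ∑ k, ∑ l, ∑ m,
    eta g x i h k * eta g x j l m * riemannUp g h.succ k.succ l.succ m.succ x

/-- Spatial norm `|X|`, where `|X|² = g^{ij} g^{kl} X_{ik} X_{jl}`. -/
def spatialNorm (g : (Fin 4 → ℝ) → Matrix (Fin 4) (Fin 4) ℝ) (x : Fin 4 → ℝ)
    (X : Matrix (Fin 3) (Fin 3) ℝ) : ℝ :=
  √(∑ i, ∑ j, ∑ k, ∑ l,
    (spatialMetric g x)⁻¹ i j * (spatialMetric g x)⁻¹ k l * X i k * X j l)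

/-! ### Robertson-Walker universes -/

/-- Coordinates of the event at time `t` and spatial coordinates `y`. -/
def event (t : ℝ) (y : Fin 3 → ℝ) : Fin 4 → ℝ := Fin.cons t y

/-- The factor `1 + k |y|² / 4`. -/
def conformal (k : ℝ) (y : Fin 3 → ℝ) : ℝ := 1 + k / 4 * ∑ i, y i ^ 2

/-- The spatial coordinate domain: all of `ℝ³` for `k = 0, 1`, the ball of radius `2` for
`k = -1`. -/
def spatialCoords (k : ℝ) : Set (Fin 3 → ℝ) := {y | 0 < conformal k y}

/-- The Robertson-Walker metric `-dt² + a(t)² dσ²`, where `dσ² = |dy|² / (1 + k |y|² / 4)²` is the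
metric of constant curvature `k` in isotropic (stereographic) coordinates. -/
def rwMetric (k : ℝ) (a : ℝ → ℝ) (x : Fin 4 → ℝ) : Matrix (Fin 4) (Fin 4) ℝ :=
  Matrix.diagonal
    (Fin.cons (-1) (fun _ : Fin 3 => a (x 0) ^ 2 / conformal k (fun i => x i.succ) ^ 2))

/-- The points of the three standard slices: the unit sphere `S³` (`k = 1`), Euclidean space
`{1} × ℝ³` (`k = 0`), the upper sheet of the unit hyperboloid (`k = -1`), as subsets of `ℝ⁴`. -/
def spaceForm (k : ℝ) : Set (Fin 4 → ℝ) :=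
  {q | q 0 ^ 2 + k * ∑ i : Fin 3, q i.succ ^ 2 = 1 ∧ (k ≤ 0 → 0 < q 0)}

/-- The charts: `e = 1` is stereographic projection from `(-1, 0)`, a global chart for `k ≤ 0`;
on the sphere the second chart `e = -1` is stereographic projection from `(1, 0)`. -/
def IsChart (k e : ℝ) : Prop := e = 1 ∨ (k = 1 ∧ e = -1)

/-- The chart domain of `chart e`. -/
def chartDomain (e : ℝ) : Set (Fin 4 → ℝ) := {q | 1 + e * q 0 ≠ 0}

/-- Coordinates of the event `P = (t, q)` in the chart `e`. In each chart the metric of the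
slice is the one of `rwMetric`. -/
def chart (e : ℝ) (P : ℝ × (Fin 4 → ℝ)) : Fin 4 → ℝ :=
  event P.1 (fun i => 2 * P.2 i.succ / (1 + e * P.2 0))

/-- A Robertson-Walker universe `I × M_k`: a time interval `I`, the curvature `k ∈ {-1, 0, 1}` of
the slices (the sphere, Euclidean space or hyperbolic space), and a positive scale factor of
class `C²` on `I`. -/
structure Universe where
  /-- curvature of the slices -/
  k : ℝ
  /-- time interval -/
  I : Set ℝ
  /-- scale factor -/
  a : ℝ → ℝ
  k_mem : k = -1 ∨ k = 0 ∨ k = 1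
  isOpen : IsOpen I
  ordConnected : I.OrdConnected
  nonempty : I.Nonempty
  a_pos : ∀ t ∈ I, 0 < a t
  a_contDiff : ContDiffOn ℝ 2 a I

/-- The two time directions. -/
inductive Direction where
  | future
  | past

namespace Universe

variable (U : Universe)

/-- The metric, in any of the charts. -/
def metric : (Fin 4 → ℝ) → Matrix (Fin 4) (Fin 4) ℝ := rwMetric U.k U.a

/-- `γ` is a geodesic of the universe on the (open) parameter set `S`. -/
def IsGeodesicOn (S : Set ℝ) (γ : ℝ → ℝ × (Fin 4 → ℝ)) : Prop :=
  ContinuousOn γ S ∧ ∀ s ∈ S, (γ s).1 ∈ U.I ∧ (γ s).2 ∈ spaceForm U.k ∧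
    ∀ e, IsChart U.k e → (γ s).2 ∈ chartDomain e →
      GeodesicEqAt U.metric (fun r => chart e (γ r)) s

/-- A vector `v` (in coordinates) points to the future or to the past. -/
def IsDirected (v : Fin 4 → ℝ) : Direction → Prop
  | .future => 0 < v 0
  | .past => v 0 < 0

/-- The geodesic with initial point `P` and initial velocity `v` (in the chart `e`) is defined for
all parameters `s ≥ 0`. -/
def GeodesicComplete (e : ℝ) (P : ℝ × (Fin 4 → ℝ)) (v : Fin 4 → ℝ) : Prop :=
  ∃ δ > 0, ∃ γ : ℝ → ℝ × (Fin 4 → ℝ), U.IsGeodesicOn (Set.Ioi (-δ)) γ ∧ γ 0 = P ∧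
    HasDerivAt (fun s => chart e (γ s)) v 0

/-- Timelike geodesic incompleteness in the direction `d`: the geodesic of some timelike initial
velocity pointing in the direction `d` is not defined for all `s ≥ 0`. -/
def TimelikeIncomplete (d : Direction) : Prop :=
  ∃ e, IsChart U.k e ∧ ∃ P : ℝ × (Fin 4 → ℝ), P.1 ∈ U.I ∧ P.2 ∈ spaceForm U.k ∧
    P.2 ∈ chartDomain e ∧ ∃ v : Fin 4 → ℝ, IsDirected v d ∧
      normSq U.metric (chart e P) v < 0 ∧ ¬ U.GeodesicComplete e P v

/-- Null geodesic incompleteness in the direction `d`. -/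
def NullIncomplete (d : Direction) : Prop :=
  ∃ e, IsChart U.k e ∧ ∃ P : ℝ × (Fin 4 → ℝ), P.1 ∈ U.I ∧ P.2 ∈ spaceForm U.k ∧
    P.2 ∈ chartDomain e ∧ ∃ v : Fin 4 → ℝ, IsDirected v d ∧
      normSq U.metric (chart e P) v = 0 ∧ ¬ U.GeodesicComplete e P v

/-- Regular hyperbolicity: the spatial metrics are uniformly bounded below by a fixed one
`g_{t₀}`, that is `A g_{t₀} ≤ g_t` for some `A > 0`. (The lapse is `1` and the shift is `0`, so that
their bounds hold trivially.) -/
def RegularlyHyperbolic : Prop :=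
  ∃ t₀ ∈ U.I, ∃ A > 0, ∀ t ∈ U.I, ∀ y ∈ spatialCoords U.k, ∀ v : Fin 3 → ℝ,
    A * ∑ i, ∑ j, spatialMetric U.metric (event t₀ y) i j * v i * v j ≤
      ∑ i, ∑ j, spatialMetric U.metric (event t y) i j * v i * v j

/-- Einstein's equations `G_{ij} = κ T_{ij}` for a perfect fluid at rest in the slices, with
density `μ` and pressure `p`: `T_{ij} = (μ + p) u_i u_j + p g_{ij}`, `u = ∂_t`. -/
def IsFluid (κ : ℝ) (μ p : ℝ → ℝ) : Prop :=
  ∀ t ∈ U.I, ∀ y ∈ spatialCoords U.k, ∀ i j : Fin 4,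
    einstein U.metric i j (event t y) =
      κ * ((μ t + p t) * U.metric (event t y) i 0 * U.metric (event t y) j 0
        + p t * U.metric (event t y) i j)

/-- `|E|` at time `t`, at the point with spatial coordinates `y`. -/
def normE (y : Fin 3 → ℝ) (t : ℝ) : ℝ :=
  spatialNorm U.metric (event t y) (electricE U.metric (event t y))

/-- `|D|` at time `t`, at the point with spatial coordinates `y`. -/
def normD (y : Fin 3 → ℝ) (t : ℝ) : ℝ :=
  spatialNorm U.metric (event t y) (electricD U.metric (event t y))

/-- `ts` is the finite time at which the universe ends (in the direction `d`). -/
def IsEndTime (ts : ℝ) : Direction → Prop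
  | .future => IsLUB U.I ts
  | .past => IsGLB U.I ts

end Universe

/-! ### Behaviours -/

/-- Two readings of `f → ∞`: `f` is not bounded above, or `f` has the limit `∞`. -/
inductive Reading where
  | unbounded
  | limit

/-- `f < ∞` along `l`: `f` stays bounded above. -/
def StaysFinite (l : Filter ℝ) (f : ℝ → ℝ) : Prop :=
  ∃ C : ℝ, ∀ᶠ t in l, f t ≤ C

/-- `f → ∞` along `l`. -/
def Diverges (l : Filter ℝ) (f : ℝ → ℝ) : Reading → Prop
  | .unbounded => ¬ StaysFinite l f
  | .limit => Tendsto f l atTop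

/-- `f` has a finite or infinite limit along `l`. -/
def HasLimit (l : Filter ℝ) (f : ℝ → ℝ) : Prop :=
  ∃ L : EReal, Tendsto (fun t => (f t : EReal)) l (𝓝 L)

/-- `B₁`: `|E| → ∞` and `|D| → ∞`. -/
def B1 (r : Reading) (l : Filter ℝ) (E D : ℝ → ℝ) : Prop := Diverges l E r ∧ Diverges l D r

/-- `B₂`: `|E| < ∞` and `|D| → ∞`. -/
def B2 (r : Reading) (l : Filter ℝ) (E D : ℝ → ℝ) : Prop := StaysFinite l E ∧ Diverges l D r

/-- `B₃`: `|E| → ∞` and `|D| < ∞`. -/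
def B3 (r : Reading) (l : Filter ℝ) (E D : ℝ → ℝ) : Prop := Diverges l E r ∧ StaysFinite l D

/-- `B₄`: `|E| < ∞` and `|D| < ∞`. -/
def B4 (l : Filter ℝ) (E D : ℝ → ℝ) : Prop := StaysFinite l E ∧ StaysFinite l D

/-- One of the four behaviours occurs. -/
def SomeB (r : Reading) (l : Filter ℝ) (E D : ℝ → ℝ) : Prop :=
  B1 r l E D ∨ B2 r l E D ∨ B3 r l E D ∨ B4 l E D

end FRW

end

noncomputable section

namespace FRW

/-! ### Partial derivatives -/

/-! By isotropy both electric tensors are multiples of the slice metric `h = a² dσ²`: `E = (a''/a)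
h` and `D = ((a'² + k)/a²) h`. Hence `|E| = √3 |a''/a|` and `|D| = √3 |(a'² + k)/a²|`, independently
of the point. The Friedmann equations read `κμ = 3(a'² + k)/a²` and `κ(μ + 3p) = -6a''/a`, so `|E|`
and `|D|` are constant multiples of `|μ + 3p|` and `|μ|` (`normE_eq`, `normD_eq`, `IsFluid.density`,
`IsFluid.acceleration`).

It remains to replace `|μ|` by `μ`. Regular hyperbolicity gives `a² ≥ A > 0`, and `k ≥ -1` then
bounds `μ` below. So `|D|` and `μ` dominate each other up to positive affine maps (`LeAffine`),
which transfers boundedness and divergence in either reading. When `μ` stays finite, `|μ|` is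
bounded, and `|p|` and `|μ + 3p|` are comparable in the same sense.

Finiteness of `t_s` is proved by contraposition (`geodesicComplete`). In a universe unbounded in a
time direction, a causal geodesic pointing there is built explicitly: its spatial part is a geodesic
of the space form in a parameter `θ` with `θ' = 1/a²`, and its time satisfies `t' = ±√(m + ω/a²)`,
where `-m` is the squared length of the velocity and `ω` the conserved squared momentum. Since `a² ≥
A`, this speed is bounded, so `t` cannot blow up and the geodesic lives for all `s ≥ 0`. -/

/-- `f` has the partial derivative `f'` with respect to the `i`-th coordinate at `x`. -/
def HasPD (i : Fin 4) (f : (Fin 4 → ℝ) → ℝ) (f' : ℝ) (x : Fin 4 → ℝ) : Prop :=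
  HasDerivAt (fun s => f (Function.update x i s)) f' (x i)

theorem HasPD.pd_eq {i : Fin 4} {f : (Fin 4 → ℝ) → ℝ} {f' : ℝ} {x : Fin 4 → ℝ}
    (h : HasPD i f f' x) : pd i f x = f' :=
  HasDerivAt.deriv h

/-- The closed formulas for the Christoffel symbols hold only where `a` and `phi` do not vanish;
differentiating them requires agreement near the point only. -/
theorem pd_congr {i : Fin 4} {f g : (Fin 4 → ℝ) → ℝ} {x : Fin 4 → ℝ} (h : f =ᶠ[𝓝 x] g) :
    pd i f x = pd i g x := by
  apply Filter.EventuallyEq.deriv_eq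
  have hc : Tendsto (fun s => Function.update x i s) (𝓝 (x i)) (𝓝 x) := by
    have : Continuous (fun s => Function.update x i s) := by fun_prop
    simpa using this.tendsto (x i)
  exact hc.eventually h

theorem hasPD_const (i : Fin 4) (c : ℝ) (x : Fin 4 → ℝ) : HasPD i (fun _ => c) 0 x :=
  hasDerivAt_const _ _

theorem HasPD.add {i : Fin 4} {f g : (Fin 4 → ℝ) → ℝ} {f' g' : ℝ} {x : Fin 4 → ℝ}
    (hf : HasPD i f f' x) (hg : HasPD i g g' x) : HasPD i (fun y => f y + g y) (f' + g') x :=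
  HasDerivAt.fun_add hf hg

theorem HasPD.sub {i : Fin 4} {f g : (Fin 4 → ℝ) → ℝ} {f' g' : ℝ} {x : Fin 4 → ℝ}
    (hf : HasPD i f f' x) (hg : HasPD i g g' x) : HasPD i (fun y => f y - g y) (f' - g') x :=
  HasDerivAt.fun_sub hf hg

theorem HasPD.const_mul {i : Fin 4} {f : (Fin 4 → ℝ) → ℝ} {f' : ℝ} {x : Fin 4 → ℝ} (c : ℝ)
    (hf : HasPD i f f' x) : HasPD i (fun y => c * f y) (c * f') x :=
  HasDerivAt.const_mul c hf

theorem HasPD.mul {i : Fin 4} {f g : (Fin 4 → ℝ) → ℝ} {f' g' : ℝ} {x : Fin 4 → ℝ}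
    (hf : HasPD i f f' x) (hg : HasPD i g g' x) :
    HasPD i (fun y => f y * g y) (f' * g x + f x * g') x := by
  have := HasDerivAt.fun_mul hf hg
  simpa [HasPD] using this

theorem HasPD.div {i : Fin 4} {f g : (Fin 4 → ℝ) → ℝ} {f' g' : ℝ} {x : Fin 4 → ℝ}
    (hf : HasPD i f f' x) (hg : HasPD i g g' x) (h0 : g x ≠ 0) :
    HasPD i (fun y => f y / g y) ((f' * g x - f x * g') / g x ^ 2) x := by
  have := HasDerivAt.fun_div hf hg (by simpa using h0)
  simpa [HasPD] using this

theorem HasPD.sq {i : Fin 4} {f : (Fin 4 → ℝ) → ℝ} {f' : ℝ} {x : Fin 4 → ℝ}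
    (hf : HasPD i f f' x) : HasPD i (fun y => f y ^ 2) (2 * f x * f') x := by
  have := HasDerivAt.fun_pow hf 2
  simpa [HasPD] using this

theorem HasPD.ite {i : Fin 4} {f : (Fin 4 → ℝ) → ℝ} {f' : ℝ} {x : Fin 4 → ℝ}
    (P : Prop) [Decidable P] (hf : HasPD i f f' x) :
    HasPD i (fun y => if P then f y else 0) (if P then f' else 0) x := by
  split_ifs
  · exact hf
  · exact hasPD_const _ _ _

theorem hasPD_time {b : ℝ → ℝ} {b' : ℝ} {x : Fin 4 → ℝ} (h : HasDerivAt b b' (x 0)) :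
    HasPD 0 (fun y => b (y 0)) b' x := by
  simpa [HasPD] using h

theorem hasPD_succ_time (b : ℝ → ℝ) (i : Fin 3) (x : Fin 4 → ℝ) :
    HasPD i.succ (fun y => b (y 0)) 0 x := by
  simpa [HasPD, Function.update_of_ne (Fin.succ_ne_zero i).symm] using
    hasDerivAt_const (x i.succ) (b (x 0))

theorem hasPD_zero_space (F : (Fin 3 → ℝ) → ℝ) (x : Fin 4 → ℝ) :
    HasPD 0 (fun y => F (fun i => y i.succ)) 0 x := by
  simpa [HasPD, Function.update_of_ne (Fin.succ_ne_zero _)] using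
    hasDerivAt_const (x 0) (F (fun i => x i.succ))

theorem hasPD_coord (i j : Fin 3) (x : Fin 4 → ℝ) :
    HasPD i.succ (fun y => y j.succ) (if i = j then 1 else 0) x := by
  unfold HasPD
  split_ifs with h
  · subst h
    simpa using hasDerivAt_id' (x i.succ)
  · have : j.succ ≠ i.succ := fun h' => h (Fin.succ_injective _ h').symm
    simpa [Function.update_of_ne this] using hasDerivAt_const (x i.succ) (x j.succ)

/-! ### The Robertson-Walker metric -/

/-- The conformal factor of the slices, as a function on space-time coordinates. -/
def phi (k : ℝ) (x : Fin 4 → ℝ) : ℝ := conformal k (fun i => x i.succ)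

theorem continuous_phi (k : ℝ) : Continuous (phi k) := by
  unfold phi conformal
  fun_prop

theorem hasPD_phi_zero (k : ℝ) (x : Fin 4 → ℝ) : HasPD 0 (phi k) 0 x :=
  hasPD_zero_space (conformal k) x

theorem hasPD_phi_succ (k : ℝ) (i : Fin 3) (x : Fin 4 → ℝ) :
    HasPD i.succ (phi k) (k / 2 * x i.succ) x := by
  have h := fun j => (hasPD_coord i j x).sq
  have := (hasPD_const i.succ 1 x).add (((h 0).add ((h 1).add (h 2))).const_mul (k / 4))
  convert this using 1
  · funext y
    simp [phi, conformal, Fin.sum_univ_three, add_assoc]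
  · fin_cases i <;> simp <;> ring

theorem rwMetric_zero_zero (k : ℝ) (a : ℝ → ℝ) (x : Fin 4 → ℝ) : rwMetric k a x 0 0 = -1 := by
  simp [rwMetric]

theorem rwMetric_zero_succ (k : ℝ) (a : ℝ → ℝ) (x : Fin 4 → ℝ) (i : Fin 3) :
    rwMetric k a x 0 i.succ = 0 := by
  simp [rwMetric, (Fin.succ_ne_zero i).symm]

theorem rwMetric_succ_zero (k : ℝ) (a : ℝ → ℝ) (x : Fin 4 → ℝ) (i : Fin 3) :
    rwMetric k a x i.succ 0 = 0 := by
  simp [rwMetric]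

theorem rwMetric_succ_succ (k : ℝ) (a : ℝ → ℝ) (x : Fin 4 → ℝ) (i j : Fin 3) :
    rwMetric k a x i.succ j.succ = if i = j then a (x 0) ^ 2 / phi k x ^ 2 else 0 := by
  simp [rwMetric, Matrix.diagonal_apply, phi]

theorem rwMetric_inv {k : ℝ} {a : ℝ → ℝ} {x : Fin 4 → ℝ} (ha : a (x 0) ≠ 0) (hφ : phi k x ≠ 0) :
    (rwMetric k a x)⁻¹ =
      Matrix.diagonal (Fin.cons (-1) (fun _ : Fin 3 => phi k x ^ 2 / a (x 0) ^ 2)) := by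
  apply Matrix.inv_eq_right_inv
  rw [rwMetric, Matrix.diagonal_mul_diagonal, ← Matrix.diagonal_one]
  congr 1
  funext i
  refine Fin.cases ?_ (fun j => ?_) i
  · simp
  · simp only [Fin.cons_succ]
    change a (x 0) ^ 2 / phi k x ^ 2 * _ = 1
    field_simp

theorem pd_rwMetric_zero_zero (k : ℝ) (a : ℝ → ℝ) (m : Fin 4) (x : Fin 4 → ℝ) :
    pd m (fun y => rwMetric k a y 0 0) x = 0 := by
  simp only [rwMetric_zero_zero]; exact (hasPD_const _ _ _).pd_eq

theorem pd_rwMetric_zero_succ (k : ℝ) (a : ℝ → ℝ) (m : Fin 4) (i : Fin 3) (x : Fin 4 → ℝ) :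
    pd m (fun y => rwMetric k a y 0 i.succ) x = 0 := by
  simp only [rwMetric_zero_succ]; exact (hasPD_const _ _ _).pd_eq

theorem pd_rwMetric_succ_zero (k : ℝ) (a : ℝ → ℝ) (m : Fin 4) (i : Fin 3) (x : Fin 4 → ℝ) :
    pd m (fun y => rwMetric k a y i.succ 0) x = 0 := by
  simp only [rwMetric_succ_zero]; exact (hasPD_const _ _ _).pd_eq

theorem pd_zero_rwMetric {k : ℝ} {a : ℝ → ℝ} {a' : ℝ} {x : Fin 4 → ℝ}
    (ha : HasDerivAt a a' (x 0)) (hφ : phi k x ≠ 0) (i j : Fin 3) :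
    pd 0 (fun y => rwMetric k a y i.succ j.succ) x =
      if i = j then 2 * a (x 0) * a' / phi k x ^ 2 else 0 := by
  simp only [rwMetric_succ_succ]
  rw [(((hasPD_time ha).sq.div (hasPD_phi_zero k x).sq (pow_ne_zero 2 hφ)).ite _).pd_eq]
  congr 1
  field_simp
  ring

theorem pd_succ_rwMetric {k : ℝ} (a : ℝ → ℝ) {x : Fin 4 → ℝ}
    (hφ : phi k x ≠ 0) (m i j : Fin 3) :
    pd m.succ (fun y => rwMetric k a y i.succ j.succ) x =
      if i = j then -(k * a (x 0) ^ 2 * x m.succ / phi k x ^ 3) else 0 := by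
  simp only [rwMetric_succ_succ]
  rw [(((hasPD_succ_time a m x).sq.div (hasPD_phi_succ k m x).sq (pow_ne_zero 2 hφ)).ite _).pd_eq]
  congr 1
  field_simp
  ring

/-! ### Christoffel symbols -/

theorem christoffel_zero {k : ℝ} {a : ℝ → ℝ} {x : Fin 4 → ℝ}
    (ha : a (x 0) ≠ 0) (hφ : phi k x ≠ 0) (i j : Fin 4) :
    christoffel (rwMetric k a) 0 i j x = -(1 / 2) * (pd i (fun y => rwMetric k a y 0 j) x +
      pd j (fun y => rwMetric k a y 0 i) x - pd 0 (fun y => rwMetric k a y i j) x) := by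
  rw [christoffel, rwMetric_inv ha hφ, Fin.sum_univ_succ]
  simp [(Fin.succ_ne_zero _).symm]
  ring

theorem christoffel_succ {k : ℝ} {a : ℝ → ℝ} {x : Fin 4 → ℝ}
    (ha : a (x 0) ≠ 0) (hφ : phi k x ≠ 0) (l : Fin 3) (i j : Fin 4) :
    christoffel (rwMetric k a) l.succ i j x = phi k x ^ 2 / (2 * a (x 0) ^ 2) *
      (pd i (fun y => rwMetric k a y l.succ j) x +
      pd j (fun y => rwMetric k a y l.succ i) x - pd l.succ (fun y => rwMetric k a y i j) x) := by
  rw [christoffel, rwMetric_inv ha hφ, Fin.sum_univ_succ]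
  simp [Matrix.diagonal_apply]
  field_simp

section
variable {k : ℝ} {a : ℝ → ℝ} {a' : ℝ} {x : Fin 4 → ℝ}

theorem christoffel_zero_zero_zero (h0 : a (x 0) ≠ 0) (hφ : phi k x ≠ 0) :
    christoffel (rwMetric k a) 0 0 0 x = 0 := by
  simp [christoffel_zero h0 hφ, pd_rwMetric_zero_zero]

theorem christoffel_zero_zero_succ (h0 : a (x 0) ≠ 0) (hφ : phi k x ≠ 0) (j : Fin 3) :
    christoffel (rwMetric k a) 0 0 j.succ x = 0 := by
  simp [christoffel_zero h0 hφ, pd_rwMetric_zero_zero, pd_rwMetric_zero_succ]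

theorem christoffel_zero_succ_zero (h0 : a (x 0) ≠ 0) (hφ : phi k x ≠ 0) (j : Fin 3) :
    christoffel (rwMetric k a) 0 j.succ 0 x = 0 := by
  simp [christoffel_zero h0 hφ, pd_rwMetric_zero_zero, pd_rwMetric_zero_succ,
    pd_rwMetric_succ_zero]

theorem christoffel_zero_succ_succ (h0 : a (x 0) ≠ 0) (hφ : phi k x ≠ 0)
    (ha : HasDerivAt a a' (x 0)) (i j : Fin 3) :
    christoffel (rwMetric k a) 0 i.succ j.succ x =
      if i = j then a (x 0) * a' / phi k x ^ 2 else 0 := by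
  rw [christoffel_zero h0 hφ, pd_rwMetric_zero_succ, pd_rwMetric_zero_succ,
    pd_zero_rwMetric ha hφ]
  split_ifs
  · ring
  · ring

theorem christoffel_succ_zero_zero (h0 : a (x 0) ≠ 0) (hφ : phi k x ≠ 0) (l : Fin 3) :
    christoffel (rwMetric k a) l.succ 0 0 x = 0 := by
  simp [christoffel_succ h0 hφ, pd_rwMetric_zero_zero, pd_rwMetric_succ_zero]

theorem christoffel_succ_zero_succ (h0 : a (x 0) ≠ 0) (hφ : phi k x ≠ 0)
    (ha : HasDerivAt a a' (x 0)) (i j : Fin 3) :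
    christoffel (rwMetric k a) i.succ 0 j.succ x = if i = j then a' / a (x 0) else 0 := by
  rw [christoffel_succ h0 hφ, pd_rwMetric_zero_succ, pd_rwMetric_succ_zero,
    pd_zero_rwMetric ha hφ]
  split_ifs
  · field_simp; ring
  · ring

theorem christoffel_succ_succ_zero (h0 : a (x 0) ≠ 0) (hφ : phi k x ≠ 0)
    (ha : HasDerivAt a a' (x 0)) (i j : Fin 3) :
    christoffel (rwMetric k a) i.succ j.succ 0 x = if i = j then a' / a (x 0) else 0 := by
  rw [christoffel_succ h0 hφ, pd_rwMetric_succ_zero, pd_rwMetric_succ_zero,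
    pd_zero_rwMetric ha hφ]
  split_ifs
  · field_simp; ring
  · ring

theorem christoffel_succ_succ_succ (h0 : a (x 0) ≠ 0) (hφ : phi k x ≠ 0) (l i j : Fin 3) :
    christoffel (rwMetric k a) l.succ i.succ j.succ x =
      ((if i = j then x l.succ else 0) - (if l = j then x i.succ else 0)
        - (if l = i then x j.succ else 0)) * (k / 2) / phi k x := by
  rw [christoffel_succ h0 hφ, pd_succ_rwMetric a hφ, pd_succ_rwMetric a hφ,
    pd_succ_rwMetric a hφ]
  split_ifs <;> field_simp <;> ring

end

/-! ### Curvature -/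

/-- `a` is nonzero near `t`, with derivative `a₁` near `t` and second derivative `a₂` at `t`. -/
structure TwiceDiff (a a₁ : ℝ → ℝ) (a₂ t : ℝ) : Prop where
  ne_zero : ∀ᶠ s in 𝓝 t, a s ≠ 0
  deriv_one : ∀ᶠ s in 𝓝 t, HasDerivAt a (a₁ s) s
  deriv_two : HasDerivAt a₁ a₂ t

section
variable {k : ℝ} {a a₁ : ℝ → ℝ} {a₂ : ℝ} {x : Fin 4 → ℝ}

theorem TwiceDiff.eventually (h : TwiceDiff a a₁ a₂ (x 0)) (hφ : phi k x ≠ 0) :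
    ∀ᶠ y in 𝓝 x, a (y 0) ≠ 0 ∧ phi k y ≠ 0 ∧ HasDerivAt a (a₁ (y 0)) (y 0) := by
  have hc : Tendsto (fun y : Fin 4 → ℝ => y 0) (𝓝 x) (𝓝 (x 0)) := (continuous_apply 0).tendsto x
  filter_upwards [hc.eventually h.ne_zero, hc.eventually h.deriv_one,
    (continuous_phi k).continuousAt.eventually_ne hφ] with y h1 h2 h3
  exact ⟨h1, h3, h2⟩

theorem pd_christoffel_zero_zero_succ (h : TwiceDiff a a₁ a₂ (x 0)) (hφ : phi k x ≠ 0)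
    (m : Fin 4) (j : Fin 3) : pd m (christoffel (rwMetric k a) 0 0 j.succ) x = 0 := by
  rw [pd_congr ((h.eventually hφ).mono fun y hy => christoffel_zero_zero_succ hy.1 hy.2.1 j)]
  exact (hasPD_const _ _ _).pd_eq

theorem pd_christoffel_succ_zero_zero (h : TwiceDiff a a₁ a₂ (x 0)) (hφ : phi k x ≠ 0)
    (m : Fin 4) (j : Fin 3) : pd m (christoffel (rwMetric k a) j.succ 0 0) x = 0 := by
  rw [pd_congr ((h.eventually hφ).mono fun y hy => christoffel_succ_zero_zero hy.1 hy.2.1 j)]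
  exact (hasPD_const _ _ _).pd_eq

theorem pd_zero_christoffel_zero (h : TwiceDiff a a₁ a₂ (x 0)) (hφ : phi k x ≠ 0)
    (i j : Fin 3) : pd 0 (christoffel (rwMetric k a) 0 i.succ j.succ) x =
      if i = j then (a₁ (x 0) ^ 2 + a (x 0) * a₂) / phi k x ^ 2 else 0 := by
  rw [pd_congr ((h.eventually hφ).mono fun y hy =>
    christoffel_zero_succ_succ hy.1 hy.2.1 hy.2.2 i j)]
  rw [((((hasPD_time h.deriv_one.self_of_nhds).mul (hasPD_time h.deriv_two)).div
    (hasPD_phi_zero k x).sq (pow_ne_zero 2 hφ)).ite _).pd_eq]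
  congr 1
  field_simp
  ring

theorem pd_zero_christoffel_succ (h : TwiceDiff a a₁ a₂ (x 0)) (hφ : phi k x ≠ 0)
    (i j : Fin 3) : pd 0 (christoffel (rwMetric k a) i.succ j.succ 0) x =
      if i = j then (a₂ * a (x 0) - a₁ (x 0) ^ 2) / a (x 0) ^ 2 else 0 := by
  rw [pd_congr ((h.eventually hφ).mono fun y hy =>
    christoffel_succ_succ_zero hy.1 hy.2.1 hy.2.2 i j)]
  rw [(((hasPD_time h.deriv_two).div (hasPD_time h.deriv_one.self_of_nhds)
    h.ne_zero.self_of_nhds).ite _).pd_eq]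
  congr 1
  ring

theorem pd_succ_christoffel_succ (h : TwiceDiff a a₁ a₂ (x 0)) (hφ : phi k x ≠ 0)
    (m l i j : Fin 3) : pd m.succ (christoffel (rwMetric k a) l.succ i.succ j.succ) x =
      k / 2 * (((if i = j then (if m = l then 1 else 0) else 0)
        - (if l = j then (if m = i then 1 else 0) else 0)
        - (if l = i then (if m = j then 1 else 0) else 0)) * phi k x -
      ((if i = j then x l.succ else 0) - (if l = j then x i.succ else 0)
        - (if l = i then x j.succ else 0)) * (k / 2 * x m.succ)) / phi k x ^ 2 := by
  rw [pd_congr ((h.eventually hφ).mono fun y hy =>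
    christoffel_succ_succ_succ hy.1 hy.2.1 l i j)]
  rw [((((((hasPD_coord m l x).ite (i = j)).sub ((hasPD_coord m i x).ite (l = j))).sub
    ((hasPD_coord m j x).ite (l = i))).mul (hasPD_const m.succ (k / 2) x)).div
    (hasPD_phi_succ k m x) hφ).pd_eq]
  congr 1
  ring

theorem riemann_zero_zero (h : TwiceDiff a a₁ a₂ (x 0)) (hφ : phi k x ≠ 0) (i j : Fin 3) :
    riemann (rwMetric k a) 0 i.succ 0 j.succ x =
      if i = j then a (x 0) * a₂ / phi k x ^ 2 else 0 := by
  have h0 := h.ne_zero.self_of_nhds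
  have h1 := h.deriv_one.self_of_nhds
  rw [riemann, pd_zero_christoffel_zero h hφ, pd_christoffel_zero_zero_succ h hφ,
    Fin.sum_univ_succ]
  simp only [christoffel_zero_zero_zero h0 hφ, christoffel_zero_zero_succ h0 hφ,
    christoffel_zero_succ_succ h0 hφ h1, christoffel_zero_succ_zero h0 hφ,
    christoffel_succ_zero_succ h0 hφ h1]
  by_cases hij : i = j
  · subst hij
    simp
    field_simp
    ring
  · have hji : j ≠ i := fun h => hij h.symm
    simp [hij, hji]

theorem riemann_zero_zero_zero (g : (Fin 4 → ℝ) → Matrix (Fin 4) (Fin 4) ℝ) (x : Fin 4 → ℝ) :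
    riemann g 0 0 0 0 x = 0 := by
  simp [riemann]

theorem riemann_succ_zero_succ_zero (h : TwiceDiff a a₁ a₂ (x 0)) (hφ : phi k x ≠ 0)
    (i : Fin 3) : riemann (rwMetric k a) i.succ 0 i.succ 0 x = -(a₂ / a (x 0)) := by
  have h0 := h.ne_zero.self_of_nhds
  have h1 := h.deriv_one.self_of_nhds
  have h2 := pd_zero_christoffel_succ h hφ i i
  rw [riemann, pd_christoffel_succ_zero_zero h hφ, h2, Fin.sum_univ_succ]
  simp only [christoffel_zero_zero_zero h0 hφ,
    christoffel_succ_zero_zero h0 hφ, christoffel_zero_succ_zero h0 hφ,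
    christoffel_succ_succ_zero h0 hφ h1, christoffel_succ_zero_succ h0 hφ h1]
  simp
  field_simp
  ring

-- This is the Gauss equation: the slices contribute `k`, their second fundamental form `a'²`. The
-- quadratic terms in the coordinates cancel only after `phi` is replaced by its polynomial (`hp`);
-- the check runs over all index values.
set_option maxHeartbeats 2000000 in
theorem riemann_succ (h : TwiceDiff a a₁ a₂ (x 0)) (hφ : phi k x ≠ 0) (i j l m : Fin 3) :
    riemann (rwMetric k a) i.succ j.succ l.succ m.succ x =
      (a₁ (x 0) ^ 2 + k) / phi k x ^ 2 *
        ((if i = l then 1 else 0) * (if j = m then 1 else 0) -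
          (if i = m then 1 else 0) * (if j = l then 1 else 0)) := by
  have h0 := h.ne_zero.self_of_nhds
  have h1 := h.deriv_one.self_of_nhds
  have hp : phi k x = 1 + k / 4 * (x 1 ^ 2 + x 2 ^ 2 + x 3 ^ 2) := by
    simp [phi, conformal, Fin.sum_univ_three]
  rw [riemann, pd_succ_christoffel_succ h hφ, pd_succ_christoffel_succ h hφ, Fin.sum_univ_succ]
  simp only [christoffel_succ_succ_zero h0 hφ h1, christoffel_zero_succ_succ h0 hφ h1,
    christoffel_succ_succ_succ h0 hφ, Fin.sum_univ_three]
  generalize phi k x = q at *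
  generalize a₁ (x 0) = b at *
  generalize a (x 0) = c at *
  fin_cases i <;> fin_cases j <;> fin_cases l <;> fin_cases m <;> simp <;> field_simp <;>
    simp only [hp] <;> ring

end

section
variable {k : ℝ} {a a₁ : ℝ → ℝ} {a₂ : ℝ} {x : Fin 4 → ℝ}

theorem ricci_zero_zero (h : TwiceDiff a a₁ a₂ (x 0)) (hφ : phi k x ≠ 0) :
    ricci (rwMetric k a) 0 0 x = -(3 * (a₂ / a (x 0))) := by
  rw [ricci, Fin.sum_univ_succ]
  simp only [riemann_zero_zero_zero, riemann_succ_zero_succ_zero h hφ]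
  simp

theorem ricci_succ_succ (h : TwiceDiff a a₁ a₂ (x 0)) (hφ : phi k x ≠ 0) (j : Fin 3) :
    ricci (rwMetric k a) j.succ j.succ x =
      (a (x 0) * a₂ + 2 * (a₁ (x 0) ^ 2 + k)) / phi k x ^ 2 := by
  rw [ricci, Fin.sum_univ_succ]
  simp only [riemann_zero_zero h hφ, riemann_succ h hφ, Fin.sum_univ_three]
  fin_cases j <;> simp <;> ring

theorem scalarCurvature_rwMetric (h : TwiceDiff a a₁ a₂ (x 0)) (hφ : phi k x ≠ 0) :
    scalarCurvature (rwMetric k a) x =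
      6 * (a₂ / a (x 0)) + 6 * ((a₁ (x 0) ^ 2 + k) / a (x 0) ^ 2) := by
  have h0 := h.ne_zero.self_of_nhds
  rw [scalarCurvature, rwMetric_inv h0 hφ]
  simp only [Matrix.diagonal_apply, ite_mul, zero_mul, Finset.sum_ite_eq, Finset.mem_univ, if_true]
  rw [Fin.sum_univ_succ]
  simp only [ricci_zero_zero h hφ, ricci_succ_succ h hφ, Fin.cons_zero, Fin.cons_succ]
  simp
  field_simp
  ring

theorem einstein_zero_zero (h : TwiceDiff a a₁ a₂ (x 0)) (hφ : phi k x ≠ 0) :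
    einstein (rwMetric k a) 0 0 x = 3 * ((a₁ (x 0) ^ 2 + k) / a (x 0) ^ 2) := by
  rw [einstein, scalarCurvature_rwMetric h hφ, ricci_zero_zero h hφ, rwMetric_zero_zero]
  ring

theorem einstein_succ_succ (h : TwiceDiff a a₁ a₂ (x 0)) (hφ : phi k x ≠ 0) (j : Fin 3) :
    einstein (rwMetric k a) j.succ j.succ x =
      -(2 * (a₂ / a (x 0)) + (a₁ (x 0) ^ 2 + k) / a (x 0) ^ 2) *
        (a (x 0) ^ 2 / phi k x ^ 2) := by
  have h0 := h.ne_zero.self_of_nhds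
  rw [einstein, scalarCurvature_rwMetric h hφ, ricci_succ_succ h hφ, rwMetric_succ_succ,
    if_pos rfl]
  field_simp
  ring

/-! ### The electric tensors and their norms -/

theorem spatialMetric_rwMetric (k : ℝ) (a : ℝ → ℝ) (x : Fin 4 → ℝ) :
    spatialMetric (rwMetric k a) x = Matrix.diagonal fun _ => a (x 0) ^ 2 / phi k x ^ 2 := by
  ext i j
  rw [spatialMetric, rwMetric_succ_succ, Matrix.diagonal_apply]

theorem spatialMetric_inv (h0 : a (x 0) ≠ 0) (hφ : phi k x ≠ 0) :
    (spatialMetric (rwMetric k a) x)⁻¹ =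
      Matrix.diagonal fun _ => phi k x ^ 2 / a (x 0) ^ 2 := by
  apply Matrix.inv_eq_right_inv
  rw [spatialMetric_rwMetric, Matrix.diagonal_mul_diagonal, ← Matrix.diagonal_one]
  congr 1
  funext i
  field_simp

/-- The tensor is `c` times the slice metric, and the metric has squared norm `3`, the dimension of
the slices. -/
theorem spatialNorm_scalar (h0 : a (x 0) ≠ 0) (hφ : phi k x ≠ 0) (c : ℝ) :
    spatialNorm (rwMetric k a) x (fun i j => if i = j then c * (a (x 0) ^ 2 / phi k x ^ 2) else 0) =
      √3 * |c| := by
  unfold spatialNorm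
  rw [spatialMetric_inv h0 hφ, ← Real.sqrt_sq_eq_abs,
    ← Real.sqrt_mul (by norm_num : (0 : ℝ) ≤ 3)]
  congr 1
  simp [Matrix.diagonal_apply]
  field_simp

theorem electricE_rwMetric (h : TwiceDiff a a₁ a₂ (x 0)) (hφ : phi k x ≠ 0) :
    electricE (rwMetric k a) x = fun i j => if i = j then
      a₂ / a (x 0) * (a (x 0) ^ 2 / phi k x ^ 2) else 0 := by
  have h0 := h.ne_zero.self_of_nhds
  ext i j
  rw [electricE, riemann_zero_zero h hφ]
  congr 1
  field_simp

theorem riemannUp_succ (h : TwiceDiff a a₁ a₂ (x 0)) (hφ : phi k x ≠ 0) (i j l m : Fin 3) :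
    riemannUp (rwMetric k a) i.succ j.succ l.succ m.succ x =
      (a₁ (x 0) ^ 2 + k) * phi k x ^ 4 / a (x 0) ^ 6 *
        ((if i = l then 1 else 0) * (if j = m then 1 else 0) -
          (if i = m then 1 else 0) * (if j = l then 1 else 0)) := by
  have h0 := h.ne_zero.self_of_nhds
  have hup : riemannUp (rwMetric k a) i.succ j.succ l.succ m.succ x =
      phi k x ^ 6 / a (x 0) ^ 6 * riemann (rwMetric k a) i.succ j.succ l.succ m.succ x := by
    rw [riemannUp, rwMetric_inv h0 hφ]
    simp only [Matrix.diagonal_apply, ite_mul, mul_ite, mul_zero, zero_mul, Finset.sum_ite_eq,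
      Finset.mem_univ, if_true, Fin.cons_succ]
    field_simp
  rw [hup, riemann_succ h hφ]
  field_simp

theorem leviCivita_eq (i j k : Fin 3) : leviCivita i j k =
    ((if i = 0 then 1 else 0) * (if j = 1 then 1 else 0) * (if k = 2 then 1 else 0)
    - (if i = 0 then 1 else 0) * (if j = 2 then 1 else 0) * (if k = 1 then 1 else 0)
    - (if i = 1 then 1 else 0) * (if j = 0 then 1 else 0) * (if k = 2 then 1 else 0)
    + (if i = 1 then 1 else 0) * (if j = 2 then 1 else 0) * (if k = 0 then 1 else 0)
    + (if i = 2 then 1 else 0) * (if j = 0 then 1 else 0) * (if k = 1 then 1 else 0)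
    - (if i = 2 then 1 else 0) * (if j = 1 then 1 else 0) * (if k = 0 then 1 else 0)) := by
  rw [leviCivita, Matrix.det_fin_three]
  simp only [Matrix.submatrix_apply, id, Matrix.one_apply]
  change (if i = 0 then (1 : ℝ) else 0) * (if j = 1 then 1 else 0) * (if k = 2 then 1 else 0)
    - (if i = 0 then 1 else 0) * (if j = 2 then 1 else 0) * (if k = 1 then 1 else 0)
    - (if i = 1 then 1 else 0) * (if j = 0 then 1 else 0) * (if k = 2 then 1 else 0)
    + (if i = 1 then 1 else 0) * (if j = 2 then 1 else 0) * (if k = 0 then 1 else 0)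
    + (if i = 2 then 1 else 0) * (if j = 0 then 1 else 0) * (if k = 1 then 1 else 0)
    - (if i = 2 then 1 else 0) * (if j = 1 then 1 else 0) * (if k = 0 then 1 else 0) = _
  ring

/-- By antisymmetry both products of deltas contribute `ε_{ihk} ε_{jhk} = 2 δ_{ij}`. The resulting
`4` cancels the `1/4` in the definition of `D`. -/
theorem leviCivita_contraction (i j : Fin 3) :
    ∑ h, ∑ k, ∑ l, ∑ m, leviCivita i h k * leviCivita j l m *
      ((if h = l then 1 else 0) * (if k = m then 1 else 0) -
        (if h = m then 1 else 0) * (if k = l then 1 else 0)) = if i = j then 4 else 0 := by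
  simp only [mul_sub, mul_ite, mul_one, mul_zero, Finset.sum_sub_distrib, Finset.sum_ite_eq,
    Finset.mem_univ, if_true]
  fin_cases i <;> fin_cases j <;>
    simp [Fin.sum_univ_three, leviCivita_eq] <;> norm_num

theorem eta_mul_eta (i h l j m n : Fin 3) :
    eta (rwMetric k a) x i h l * eta (rwMetric k a) x j m n =
      (a (x 0) ^ 2 / phi k x ^ 2) ^ 3 * (leviCivita i h l * leviCivita j m n) := by
  have : (spatialMetric (rwMetric k a) x).det = (a (x 0) ^ 2 / phi k x ^ 2) ^ 3 := by
    rw [spatialMetric_rwMetric, Matrix.det_diagonal, Finset.prod_const, Finset.card_univ,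
      Fintype.card_fin]
  rw [eta, eta, this, mul_mul_mul_comm, Real.mul_self_sqrt (by positivity)]

theorem electricD_rwMetric (h : TwiceDiff a a₁ a₂ (x 0)) (hφ : phi k x ≠ 0) :
    electricD (rwMetric k a) x = fun i j => if i = j then
      (a₁ (x 0) ^ 2 + k) / a (x 0) ^ 2 * (a (x 0) ^ 2 / phi k x ^ 2) else 0 := by
  have h0 := h.ne_zero.self_of_nhds
  ext i j
  -- The powers combine as `(a²/φ²)³ · φ⁴/a⁶ = 1/φ²`, which gives the common factor of the
  -- contraction.
  have key := congrArg
    (fun z => (1 / 4) * ((a₁ (x 0) ^ 2 + k) / phi k x ^ 2) * z) (leviCivita_contraction i j)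
  simp only [Finset.mul_sum] at key
  simp only [electricD, riemannUp_succ h hφ, eta_mul_eta, Finset.mul_sum]
  refine Eq.trans ?_ (key.trans ?_)
  · refine Finset.sum_congr rfl fun p _ => Finset.sum_congr rfl fun q _ =>
      Finset.sum_congr rfl fun r _ => Finset.sum_congr rfl fun s _ => ?_
    generalize ((if p = r then (1 : ℝ) else 0) * (if q = s then 1 else 0) -
          (if p = s then 1 else 0) * (if q = r then 1 else 0)) = z
    field_simp
  · split_ifs
    · field_simp
    · simp

theorem norm_electricE (h : TwiceDiff a a₁ a₂ (x 0)) (hφ : phi k x ≠ 0) :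
    spatialNorm (rwMetric k a) x (electricE (rwMetric k a) x) = √3 * |a₂ / a (x 0)| := by
  rw [electricE_rwMetric h hφ, spatialNorm_scalar h.ne_zero.self_of_nhds hφ]

theorem norm_electricD (h : TwiceDiff a a₁ a₂ (x 0)) (hφ : phi k x ≠ 0) :
    spatialNorm (rwMetric k a) x (electricD (rwMetric k a) x) =
      √3 * |(a₁ (x 0) ^ 2 + k) / a (x 0) ^ 2| := by
  rw [electricD_rwMetric h hφ, spatialNorm_scalar h.ne_zero.self_of_nhds hφ]

end

/-! ### Friedmann equations and norms of the electric tensors -/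

namespace Universe

variable (U : Universe)

theorem twiceDiff {t : ℝ} (ht : t ∈ U.I) :
    TwiceDiff U.a (deriv U.a) (deriv (deriv U.a) t) t := by
  have hI := U.isOpen.mem_nhds ht
  have hd : ContDiffOn ℝ 1 (deriv U.a) U.I :=
    ((contDiffOn_succ_iff_deriv_of_isOpen (n := 1) U.isOpen).1
      (by simpa [one_add_one_eq_two] using U.a_contDiff)).2.2
  refine ⟨?_, ?_, ?_⟩
  · filter_upwards [hI] with s hs using (U.a_pos s hs).ne'
  · filter_upwards [hI] with s hs
    exact ((U.a_contDiff.differentiableOn (by norm_num)).differentiableAt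
      (U.isOpen.mem_nhds hs)).hasDerivAt
  · exact ((hd.differentiableOn (by norm_num)).differentiableAt hI).hasDerivAt

theorem phi_event (k t : ℝ) (y : Fin 3 → ℝ) : phi k (event t y) = conformal k y := by
  simp [phi, event]

theorem event_zero (t : ℝ) (y : Fin 3 → ℝ) : event t y 0 = t := rfl

theorem phi_event_ne_zero {y : Fin 3 → ℝ} (hy : y ∈ spatialCoords U.k) (t : ℝ) :
    phi U.k (event t y) ≠ 0 := by
  rw [phi_event]
  exact ne_of_gt hy

theorem normE_eq {y : Fin 3 → ℝ} (hy : y ∈ spatialCoords U.k) {t : ℝ} (ht : t ∈ U.I) :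
    U.normE y t = √3 * |deriv (deriv U.a) t / U.a t| :=
  norm_electricE (x := event t y) (U.twiceDiff ht) (U.phi_event_ne_zero hy t)

theorem normD_eq {y : Fin 3 → ℝ} (hy : y ∈ spatialCoords U.k) {t : ℝ} (ht : t ∈ U.I) :
    U.normD y t = √3 * |(deriv U.a t ^ 2 + U.k) / U.a t ^ 2| :=
  norm_electricD (x := event t y) (U.twiceDiff ht) (U.phi_event_ne_zero hy t)

theorem zero_mem_spatialCoords (k : ℝ) : (0 : Fin 3 → ℝ) ∈ spatialCoords k := by
  simp [spatialCoords, conformal]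

/-- The first Friedmann equation. -/
theorem IsFluid.density {U : Universe} {κ : ℝ} {μ p : ℝ → ℝ} (h : U.IsFluid κ μ p) {t : ℝ}
    (ht : t ∈ U.I) : κ * μ t = 3 * ((deriv U.a t ^ 2 + U.k) / U.a t ^ 2) := by
  have hy := zero_mem_spatialCoords U.k
  have := h t ht 0 hy 0 0
  rw [metric, einstein_zero_zero (x := event t 0) (U.twiceDiff ht) (U.phi_event_ne_zero hy t),
    rwMetric_zero_zero] at this
  rw [event_zero] at this
  linarith

theorem IsFluid.pressure {U : Universe} {κ : ℝ} {μ p : ℝ → ℝ} (h : U.IsFluid κ μ p) {t : ℝ}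
    (ht : t ∈ U.I) : κ * p t =
      -(2 * (deriv (deriv U.a) t / U.a t) + (deriv U.a t ^ 2 + U.k) / U.a t ^ 2) := by
  have hy := zero_mem_spatialCoords U.k
  have hφ := U.phi_event_ne_zero hy t
  have := h t ht 0 hy (Fin.succ 0) (Fin.succ 0)
  rw [metric, einstein_succ_succ (x := event t 0) (U.twiceDiff ht) hφ,
    rwMetric_succ_zero, rwMetric_succ_succ, if_pos rfl] at this
  rw [event_zero] at this
  have ha := (U.a_pos t ht).ne'
  have h2 : U.a t ^ 2 / phi U.k (event t 0) ^ 2 ≠ 0 :=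
    div_ne_zero (pow_ne_zero 2 ha) (pow_ne_zero 2 hφ)
  refine mul_right_cancel₀ h2 ?_
  rw [this]
  ring

/-- In `μ + 3p` the terms `(a'² + k)/a²` cancel, so this combination sees only `a''`, as `E` does.
-/
theorem IsFluid.acceleration {U : Universe} {κ : ℝ} {μ p : ℝ → ℝ} (h : U.IsFluid κ μ p)
    {t : ℝ} (ht : t ∈ U.I) :
    κ * (μ t + 3 * p t) = -(6 * (deriv (deriv U.a) t / U.a t)) := by
  linear_combination h.density ht + 3 * h.pressure ht

/-- Regular hyperbolicity bounds the scale factor away from zero. -/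
theorem RegularlyHyperbolic.exists_le {U : Universe} (h : U.RegularlyHyperbolic) :
    ∃ A > 0, ∀ t ∈ U.I, A ≤ U.a t ^ 2 := by
  obtain ⟨t₀, ht₀, A, hA, h⟩ := h
  refine ⟨A * U.a t₀ ^ 2, mul_pos hA (pow_pos (U.a_pos t₀ ht₀) 2), fun t ht => ?_⟩
  -- At the origin the conformal factor is `1`, so a coordinate unit vector has squared length `a²`.
  have := h t ht 0 (zero_mem_spatialCoords U.k) ![1, 0, 0]
  simp only [metric, spatialMetric_rwMetric, event_zero] at this
  simpa [Fin.sum_univ_three, phi_event, conformal, Matrix.diagonal_apply] using this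

end Universe

/-! ### Geodesics of the slices -/

/-- A globally defined positive bounded autonomous scalar equation has a global solution. -/
theorem exists_global_solution {f : ℝ → ℝ} {M : ℝ} (hf : Continuous f) (hpos : ∀ x, 0 < f x)
    (hM : ∀ x, f x ≤ M) : ∃ u : ℝ → ℝ, u 0 = 0 ∧ ∀ s, HasDerivAt u (f (u s)) s := by
  have hM0 : 0 < M := (hpos 0).trans_le (hM 0)
  have hfi : Continuous fun x => (f x)⁻¹ := hf.inv₀ fun x => (hpos x).ne'
  -- Separation of variables: `F x` is the time needed to reach `x`, and the solution is its
  -- inverse.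
  set F : ℝ → ℝ := fun x => ∫ y in (0 : ℝ)..x, (f y)⁻¹ with hF
  have hF' : ∀ x, HasDerivAt F (f x)⁻¹ x := fun x =>
    intervalIntegral.integral_hasDerivAt_right (hfi.intervalIntegrable _ _)
      (hfi.stronglyMeasurableAtFilter _ _) hfi.continuousAt
  have hF0 : F 0 = 0 := by simp [hF]
  have hmono : StrictMono F := strictMono_of_deriv_pos fun x => by
    rw [(hF' x).deriv]; exact inv_pos.2 (hpos x)
  -- Since `f ≤ M`, `F` grows at least with slope `1/M`. This makes it surjective, that is, excludes
  -- blow-up.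
  have hG : Monotone fun x => F x - M⁻¹ * x := by
    have hG' : ∀ x, HasDerivAt (fun x => F x - M⁻¹ * x) ((f x)⁻¹ - M⁻¹ * 1) x := fun x =>
      (hF' x).sub ((hasDerivAt_id' x).const_mul _)
    refine monotone_of_deriv_nonneg (fun x => (hG' x).differentiableAt) fun x => ?_
    rw [(hG' x).deriv, mul_one, sub_nonneg]
    exact inv_anti₀ (hpos x) (hM x)
  have hsurj : Function.Surjective F := by
    refine (continuous_iff_continuousAt.2 fun x => (hF' x).continuousAt).surjective ?_ ?_
    · refine tendsto_atTop_mono' _ ?_ (tendsto_id.const_mul_atTop (inv_pos.2 hM0))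
      filter_upwards [eventually_ge_atTop 0] with x hx
      have := hG hx
      simp only [hF0, mul_zero, sub_zero, id] at this ⊢
      linarith
    · refine tendsto_atBot_mono' _ ?_ (tendsto_id.const_mul_atBot (inv_pos.2 hM0))
      filter_upwards [eventually_le_atBot 0] with x hx
      have := hG hx
      simp only [hF0, mul_zero, sub_zero, id] at this ⊢
      linarith
  let Φ := hmono.orderIsoOfSurjective F hsurj
  have hΦ : ∀ y, F (Φ.symm y) = y := fun y => Φ.apply_symm_apply y
  refine ⟨Φ.symm, ?_, fun s => ?_⟩
  · exact hmono.injective (by rw [hΦ, hF0])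
  · have := HasDerivAt.of_local_left_inverse Φ.symm.continuous.continuousAt (hF' (Φ.symm s))
      (inv_pos.2 (hpos _)).ne' (Eventually.of_forall hΦ)
    simpa using this

/-- Solutions `C`, `S` of `f'' = -l f` generalizing the cosine and the sine. -/
theorem exists_cos_sin (l : ℝ) : ∃ C S : ℝ → ℝ, C 0 = 1 ∧ S 0 = 0 ∧
    (∀ θ, HasDerivAt C (-l * S θ) θ) ∧ ∀ θ, HasDerivAt S (C θ) θ := by
  rcases lt_trichotomy l 0 with h | h | h
  · obtain ⟨r, hr, rfl⟩ : ∃ r : ℝ, r ≠ 0 ∧ l = -r ^ 2 :=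
      ⟨√(-l), (Real.sqrt_pos.2 (neg_pos.2 h)).ne', by rw [Real.sq_sqrt (neg_pos.2 h).le, neg_neg]⟩
    refine ⟨fun θ => Real.cosh (r * θ), fun θ => Real.sinh (r * θ) / r,
      by simp, by simp, fun θ => ?_, fun θ => ?_⟩
    · refine ((hasDerivAt_id' θ).const_mul r).cosh.congr_deriv ?_
      field_simp
    · refine ((((hasDerivAt_id' θ).const_mul r).sinh).div_const r).congr_deriv ?_
      field_simp
  · refine ⟨fun _ => 1, fun θ => θ, rfl, rfl, fun θ => ?_, fun θ => hasDerivAt_id' θ⟩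
    simpa [h] using hasDerivAt_const θ (1 : ℝ)
  · obtain ⟨r, hr, rfl⟩ : ∃ r : ℝ, r ≠ 0 ∧ l = r ^ 2 :=
      ⟨√l, (Real.sqrt_pos.2 h).ne', (Real.sq_sqrt h.le).symm⟩
    refine ⟨fun θ => Real.cos (r * θ), fun θ => Real.sin (r * θ) / r,
      by simp, by simp, fun θ => ?_, fun θ => ?_⟩
    · refine ((hasDerivAt_id' θ).const_mul r).cos.congr_deriv ?_
      field_simp
    · refine ((((hasDerivAt_id' θ).const_mul r).sin).div_const r).congr_deriv ?_
      field_simp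

/-- A geodesic `Q` of the space form of curvature `k`, with velocity `V` and squared speed `ω`. -/
structure SpaceGeodesic (k ω : ℝ) (Q V : ℝ → Fin 4 → ℝ) : Prop where
  deriv_pos : ∀ θ i, HasDerivAt (fun r => Q r i) (V θ i) θ
  deriv_vel : ∀ θ i, HasDerivAt (fun r => V r i) (-(k * ω) * Q θ i) θ
  mem : ∀ θ, Q θ ∈ spaceForm k
  tangent : ∀ θ, Q θ 0 * V θ 0 + k * ∑ i : Fin 3, Q θ i.succ * V θ i.succ = 0
  speed : ∀ θ, k * V θ 0 ^ 2 + ∑ i : Fin 3, V θ i.succ ^ 2 = ω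

/-- The geodesic is `C q + S w` in the plane spanned by `q` and `w`, where `C`, `S` solve `f'' = -kω
f`. The form `x₀² + k|x|²` takes the value `kω` on `w`: for `k = ±1` because `k² = 1`, for `k = 0`
because tangency forces `w 0 = 0`. Conservation of `C² + kω S²` then keeps the curve on the quadric.
-/
theorem exists_spaceGeodesic {k : ℝ} (hk : k = -1 ∨ k = 0 ∨ k = 1) {q w : Fin 4 → ℝ}
    (hq : q ∈ spaceForm k) (hw : q 0 * w 0 + k * ∑ i : Fin 3, q i.succ * w i.succ = 0) :
    ∃ Q V, Q 0 = q ∧ V 0 = w ∧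
      SpaceGeodesic k (k * w 0 ^ 2 + ∑ i : Fin 3, w i.succ ^ 2) Q V := by
  set ω := k * w 0 ^ 2 + ∑ i : Fin 3, w i.succ ^ 2 with hω
  obtain ⟨hq1, hq0⟩ := hq
  simp only [Fin.sum_univ_three] at hq1 hw hω
  have hw0 : k = 0 → w 0 = 0 := fun h => by
    simpa [h, (hq0 h.le).ne'] using hw
  obtain ⟨C, S, hC0, hS0, hC, hS⟩ := exists_cos_sin (k * ω)
  have hcons : ∀ θ, C θ ^ 2 + k * ω * S θ ^ 2 = 1 := by
    have hd : ∀ θ, HasDerivAt (fun θ => C θ ^ 2 + k * ω * S θ ^ 2) 0 θ := fun θ => by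
      refine (((hC θ).fun_pow 2).fun_add (((hS θ).fun_pow 2).const_mul (k * ω))).congr_deriv ?_
      push_cast; ring
    intro θ
    have := is_const_of_deriv_eq_zero (fun θ => (hd θ).differentiableAt)
      (fun θ => (hd θ).deriv) θ 0
    simpa [hC0, hS0] using this
  have hQ' : ∀ θ i, HasDerivAt (fun r => C r * q i + S r * w i)
      (-(k * ω) * S θ * q i + C θ * w i) θ := fun θ i =>
    ((hC θ).mul_const _).fun_add ((hS θ).mul_const _)
  have hω' : w 0 ^ 2 + k * (w (Fin.succ 0) ^ 2 + w (Fin.succ 1) ^ 2 + w (Fin.succ 2) ^ 2)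
      = k * ω := by
    rcases hk with h | h | h
    · rw [hω, h]; ring
    · rw [hω, hw0 h, h]; ring
    · rw [hω, h]; ring
  have hmem : ∀ θ, (C θ * q 0 + S θ * w 0) ^ 2 +
      k * ∑ i : Fin 3, (C θ * q i.succ + S θ * w i.succ) ^ 2 = 1 := fun θ => by
    simp only [Fin.sum_univ_three]
    linear_combination C θ ^ 2 * hq1 + 2 * C θ * S θ * hw + S θ ^ 2 * hω' + hcons θ
  refine ⟨fun θ i => C θ * q i + S θ * w i, fun θ i => -(k * ω) * S θ * q i + C θ * w i,
    by simp [hC0, hS0], by simp [hC0, hS0], ⟨hQ', fun θ i => ?_, fun θ => ⟨hmem θ, fun hk0 => ?_⟩,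
    fun θ => ?_, fun θ => ?_⟩⟩
  · refine ((((hS θ).const_mul (-(k * ω))).mul_const (q i)).fun_add
      ((hC θ).mul_const (w i))).congr_deriv ?_
    ring
  -- Leaving the upper sheet would mean crossing `q 0 = 0`, where the quadric equation becomes
  -- `k|q|² = 1`, impossible for `k ≤ 0`.
  · by_contra! hneg
    have hcont : Continuous fun θ => C θ * q 0 + S θ * w 0 :=
      continuous_iff_continuousAt.2 fun θ => (hQ' θ 0).continuousAt
    have h0 : 0 < C 0 * q 0 + S 0 * w 0 := by simpa [hC0, hS0] using hq0 hk0
    obtain ⟨z, hz⟩ := mem_range_of_exists_le_of_exists_ge hcont ⟨θ, hneg⟩ ⟨0, h0.le⟩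
    have hm := hmem z
    simp only at hz
    rw [hz] at hm
    have : 0 ≤ ∑ i : Fin 3, (C z * q i.succ + S z * w i.succ) ^ 2 :=
      Finset.sum_nonneg fun i _ => sq_nonneg _
    nlinarith
  · simp only [Fin.sum_univ_three]
    linear_combination (-(k * ω) * S θ * C θ) * hq1 + (C θ ^ 2 - k * ω * S θ ^ 2) * hw +
      C θ * S θ * hω'
  · simp only [Fin.sum_univ_three]
    rcases hk with h | h | h
    · subst h
      linear_combination (-ω ^ 2 * S θ ^ 2) * hq1 + (-2 * ω * S θ * C θ) * hw -
        C θ ^ 2 * hω + ω * hcons θ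
    · subst h
      linear_combination -C θ ^ 2 * hω + ω * hcons θ
    · subst h
      linear_combination (ω ^ 2 * S θ ^ 2) * hq1 - (2 * ω * S θ * C θ) * hw -
        C θ ^ 2 * hω + ω * hcons θ

/-! ### Geodesics of the slices in a chart -/

/-- Coordinate representation of a velocity `w` at `q`. -/
def chartVel (e : ℝ) (q w : Fin 4 → ℝ) (i : Fin 3) : ℝ :=
  2 * w i.succ / (1 + e * q 0) - 2 * q i.succ * (e * w 0) / (1 + e * q 0) ^ 2

theorem IsChart.sq_eq {k e : ℝ} (h : IsChart k e) : e ^ 2 = 1 := by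
  rcases h with h | ⟨-, h⟩ <;> rw [h] <;> norm_num

section
variable {k ω e : ℝ} {q w : Fin 4 → ℝ}

/-- On the quadric `k|q|² = 1 - q₀² = (1 - e q₀)(1 + e q₀)`. -/
theorem conformal_chart (he : e ^ 2 = 1) (hq : q ∈ spaceForm k) (hD : 1 + e * q 0 ≠ 0) :
    conformal k (fun i => 2 * q i.succ / (1 + e * q 0)) = 2 / (1 + e * q 0) := by
  have h1 := hq.1
  simp only [Fin.sum_univ_three] at h1
  simp only [conformal, Fin.sum_univ_three]
  field_simp
  linear_combination 4 * h1 + 4 * q 0 ^ 2 * he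

/-- Twice the derivative of `conformal_chart` in the direction `w`; it evaluates the radial term of
the geodesic equation. -/
theorem chart_mul_chartVel (he : e ^ 2 = 1) (hq : q ∈ spaceForm k) (hD : 1 + e * q 0 ≠ 0)
    (hw : q 0 * w 0 + k * ∑ i : Fin 3, q i.succ * w i.succ = 0) :
    k * ∑ i : Fin 3, 2 * q i.succ / (1 + e * q 0) * chartVel e q w i =
      -(4 * e * w 0) / (1 + e * q 0) ^ 2 := by
  have h1 := hq.1
  simp only [Fin.sum_univ_three] at h1 hw
  simp only [chartVel, Fin.sum_univ_three]
  field_simp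
  linear_combination 4 * (1 + e * q 0) * hw - 4 * e * w 0 * h1 + 4 * q 0 * w 0 * he

/-- Stereographic projection is conformal with factor `2 / (1 + e q₀)`, which equals `conformal` at
the image point. So `ω` is the squared speed in the slice metric `dσ²`. -/
theorem sum_chartVel_sq (hk : k = -1 ∨ k = 0 ∨ k = 1) (he : e ^ 2 = 1) (hq : q ∈ spaceForm k)
    (hD : 1 + e * q 0 ≠ 0)
    (hw : q 0 * w 0 + k * ∑ i : Fin 3, q i.succ * w i.succ = 0)
    (hω : k * w 0 ^ 2 + ∑ i : Fin 3, w i.succ ^ 2 = ω) :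
    ∑ i, chartVel e q w i ^ 2 = 4 * ω / (1 + e * q 0) ^ 2 := by
  obtain ⟨h1, h0⟩ := hq
  have hw0 : k = 0 → w 0 = 0 := fun h => by
    simpa [h, (h0 h.le).ne'] using hw
  simp only [Fin.sum_univ_three] at h1 hw hω
  simp only [chartVel, Fin.sum_univ_three]
  rcases hk with h | h | h
  · subst h
    field_simp
    linear_combination 4 * (1 + e * q 0) ^ 2 * hω + 8 * (1 + e * q 0) * e * w 0 * hw -
      4 * w 0 ^ 2 * e ^ 2 * h1 - 4 * w 0 ^ 2 * he
  · have h2 := hw0 h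
    subst h
    simp only [h2]
    field_simp
    linear_combination 4 * (1 + e * q 0) ^ 2 * hω
  · subst h
    field_simp
    linear_combination 4 * (1 + e * q 0) ^ 2 * hω - 8 * (1 + e * q 0) * e * w 0 * hw +
      4 * w 0 ^ 2 * e ^ 2 * h1 + 4 * w 0 ^ 2 * he

end

theorem SpaceGeodesic.hasDerivAt_chart {k ω e : ℝ} {Q V : ℝ → Fin 4 → ℝ}
    (h : SpaceGeodesic k ω Q V) {θ : ℝ} (hD : 1 + e * Q θ 0 ≠ 0) (i : Fin 3) :
    HasDerivAt (fun r => 2 * Q r i.succ / (1 + e * Q r 0)) (chartVel e (Q θ) (V θ) i) θ := by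
  refine (((h.deriv_pos θ i.succ).const_mul 2).fun_div
    (((h.deriv_pos θ 0).const_mul e).const_add 1) hD).congr_deriv ?_
  rw [chartVel]
  field_simp

theorem SpaceGeodesic.hasDerivAt_chartVel {k ω e : ℝ} {Q V : ℝ → Fin 4 → ℝ}
    (h : SpaceGeodesic k ω Q V) {θ : ℝ}
    (hD : 1 + e * Q θ 0 ≠ 0) (i : Fin 3) :
    HasDerivAt (fun r => chartVel e (Q r) (V r) i)
      (-(2 * e * V θ 0 / (1 + e * Q θ 0)) * chartVel e (Q θ) (V θ) i
        - 2 * k * ω * Q θ i.succ / (1 + e * Q θ 0) ^ 2) θ := by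
  have hd := ((h.deriv_pos θ 0).const_mul e).const_add 1
  refine ((((h.deriv_vel θ i.succ).const_mul 2).fun_div hd hD).fun_sub
    ((((h.deriv_pos θ i.succ).const_mul 2).fun_mul ((h.deriv_vel θ 0).const_mul e)).fun_div
      (hd.fun_pow 2) (pow_ne_zero 2 hD))).congr_deriv ?_
  rw [chartVel]
  push_cast
  field_simp
  ring

section
variable {k : ℝ} {a : ℝ → ℝ} {a' : ℝ} {x : Fin 4 → ℝ}

theorem sum_christoffel_zero (h0 : a (x 0) ≠ 0) (hφ : phi k x ≠ 0)
    (ha : HasDerivAt a a' (x 0)) (v : Fin 4 → ℝ) :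
    ∑ i, ∑ j, christoffel (rwMetric k a) 0 i j x * v i * v j =
      a (x 0) * a' / phi k x ^ 2 * ∑ i : Fin 3, v i.succ ^ 2 := by
  simp only [Fin.sum_univ_succ (n := 3), christoffel_zero_zero_zero h0 hφ,
    christoffel_zero_zero_succ h0 hφ, christoffel_zero_succ_zero h0 hφ,
    christoffel_zero_succ_succ h0 hφ ha, ite_mul, zero_mul, Finset.sum_ite_eq, Finset.mem_univ,
    if_true, Finset.sum_const_zero, zero_add, Finset.mul_sum]
  exact Finset.sum_congr rfl fun i _ => by ring

theorem sum_christoffel_succ (h0 : a (x 0) ≠ 0) (hφ : phi k x ≠ 0)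
    (ha : HasDerivAt a a' (x 0)) (v : Fin 4 → ℝ) (l : Fin 3) :
    ∑ i, ∑ j, christoffel (rwMetric k a) l.succ i j x * v i * v j =
      2 * (a' / a (x 0)) * v 0 * v l.succ +
        (k / 2 * x l.succ * ∑ i : Fin 3, v i.succ ^ 2
          - v l.succ * (k * ∑ i : Fin 3, x i.succ * v i.succ)) / phi k x := by
  simp only [Fin.sum_univ_succ (n := 3), christoffel_succ_zero_zero h0 hφ,
    christoffel_succ_zero_succ h0 hφ ha, christoffel_succ_succ_zero h0 hφ ha,
    christoffel_succ_succ_succ h0 hφ]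
  simp only [Fin.sum_univ_three]
  fin_cases l <;> simp <;> ring

end

/-- A curve whose spatial part is a reparametrised geodesic of the space form, and whose time
coordinate has the first integral of the motion, satisfies the geodesic equation. -/
theorem geodesicEqAt_chart {k ω e a' s : ℝ} {a t τ θ : ℝ → ℝ} {Q V : ℝ → Fin 4 → ℝ}
    (hk : k = -1 ∨ k = 0 ∨ k = 1) (he : e ^ 2 = 1) (h : SpaceGeodesic k ω Q V)
    (hD : 1 + e * Q (θ s) 0 ≠ 0) (ha0 : ∀ᶠ r in 𝓝 s, a (t r) ≠ 0)
    (ht : ∀ᶠ r in 𝓝 s, HasDerivAt t (τ r) r)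
    (hθ : ∀ᶠ r in 𝓝 s, HasDerivAt θ (1 / a (t r) ^ 2) r)
    (hτ : HasDerivAt τ (-(a' * ω / a (t s) ^ 3)) s) (ha : HasDerivAt a a' (t s)) :
    GeodesicEqAt (rwMetric k a) (fun r => chart e (t r, Q (θ r))) s := by
  have hθc : ContinuousAt θ s := hθ.self_of_nhds.continuousAt
  have hDn : ∀ᶠ r in 𝓝 s, 1 + e * Q (θ r) 0 ≠ 0 := by
    have : ContinuousAt (fun r => 1 + e * Q (θ r) 0) s :=
      (((h.deriv_pos (θ s) 0).continuousAt.comp (f := θ) hθc).const_mul e).const_add 1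
    exact this.eventually_ne hD
  have hder : ∀ᶠ r in 𝓝 s, HasDerivAt (fun r => chart e (t r, Q (θ r)))
      (event (τ r) fun i => chartVel e (Q (θ r)) (V (θ r)) i * (1 / a (t r) ^ 2)) r := by
    filter_upwards [hDn, ht, hθ] with r h1 h2 h3
    rw [hasDerivAt_pi]
    intro i
    refine Fin.cases ?_ (fun j => ?_) i
    · exact h2
    · exact (h.hasDerivAt_chart h1 j).comp r h3
  have hdE : ∀ᶠ r in 𝓝 s, deriv (fun r => chart e (t r, Q (θ r))) r =
      event (τ r) fun i => chartVel e (Q (θ r)) (V (θ r)) i * (1 / a (t r) ^ 2) :=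
    hder.mono fun r hr => hr.deriv
  refine ⟨hder.mono fun r hr => hr.differentiableAt, fun i => ?_⟩
  have hφ : phi k (chart e (t s, Q (θ s))) = 2 / (1 + e * Q (θ s) 0) :=
    conformal_chart he (h.mem _) hD
  have hφ0 : phi k (chart e (t s, Q (θ s))) ≠ 0 := by
    rw [hφ]; exact div_ne_zero two_ne_zero hD
  have h0 := ha0.self_of_nhds
  have hx0 : chart e (t s, Q (θ s)) 0 = t s := rfl
  have hxs : ∀ i : Fin 3, chart e (t s, Q (θ s)) i.succ = 2 * Q (θ s) i.succ /
      (1 + e * Q (θ s) 0) := fun i => rfl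
  have hsq := sum_chartVel_sq hk he (h.mem (θ s)) hD (h.tangent (θ s)) (h.speed (θ s))
  have hxv := chart_mul_chartVel he (h.mem (θ s)) hD (h.tangent (θ s))
  simp only [hdE.self_of_nhds]
  have hsq' : ∑ i : Fin 3, event (τ s)
      (fun i => chartVel e (Q (θ s)) (V (θ s)) i * (1 / a (t s) ^ 2)) i.succ ^ 2 =
      4 * ω / (1 + e * Q (θ s) 0) ^ 2 * (1 / a (t s) ^ 2) ^ 2 := by
    rw [← hsq, Finset.sum_mul]
    exact Finset.sum_congr rfl fun i _ => mul_pow _ _ _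
  have hxv' : k * ∑ i : Fin 3, 2 * Q (θ s) i.succ / (1 + e * Q (θ s) 0) * event (τ s)
      (fun i => chartVel e (Q (θ s)) (V (θ s)) i * (1 / a (t s) ^ 2)) i.succ =
      -(4 * e * V (θ s) 0) / (1 + e * Q (θ s) 0) ^ 2 * (1 / a (t s) ^ 2) := by
    rw [← hxv, mul_assoc, Finset.sum_mul]
    congr 1
    exact Finset.sum_congr rfl fun i _ => (mul_assoc _ _ _).symm
  refine Fin.cases ?_ (fun j => ?_) i
  · refine HasDerivAt.congr_of_eventuallyEq (hτ.congr_deriv ?_)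
      (hdE.mono fun r hr => congrFun hr 0)
    rw [sum_christoffel_zero (by exact h0) hφ0 (by exact ha), hsq', hφ, hx0]
    field_simp
    norm_num
  -- Differentiating the rate `θ' = 1/a²` produces exactly the friction term `-2(a'/a) t'` of the
  -- geodesic equation.
  · have hinv : HasDerivAt (fun r => 1 / a (t r) ^ 2) (-(2 * a' * τ s / a (t s) ^ 3)) s := by
      refine ((hasDerivAt_const s (1 : ℝ)).fun_div (((ha.comp s ht.self_of_nhds).fun_pow 2))
        (pow_ne_zero 2 h0)).congr_deriv ?_
      simp only [Function.comp]
      push_cast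
      field_simp
      ring
    refine HasDerivAt.congr_of_eventuallyEq
      ((((h.hasDerivAt_chartVel hD j).comp s hθ.self_of_nhds).fun_mul hinv).congr_deriv ?_)
      (hdE.mono fun r hr => congrFun hr j.succ)
    rw [sum_christoffel_succ (by exact h0) hφ0 (by exact ha)]
    simp only [hxs, hx0]
    rw [hsq', hxv', hφ]
    have e1 : ∀ f : Fin 3 → ℝ, event (τ s) f 0 = τ s := fun _ => rfl
    have e2 : ∀ f : Fin 3 → ℝ, event (τ s) f j.succ = f j := fun _ => rfl
    simp only [e1, e2, Function.comp]
    generalize chartVel e (Q (θ s)) (V (θ s)) j = c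
    field_simp
    ring

/-- The sign of the time coordinate in a time direction. -/
def Direction.sign : Direction → ℝ
  | .future => 1
  | .past => -1

theorem Direction.sign_sq (d : Direction) : d.sign ^ 2 = 1 := by
  cases d <;> simp [Direction.sign]

namespace Universe

theorem sign_mul_abs {v : Fin 4 → ℝ} {d : Direction} (h : IsDirected v d) :
    d.sign * |v 0| = v 0 := by
  cases d
  · simp [Direction.sign, abs_of_pos (show 0 < v 0 from h)]
  · simp [Direction.sign, abs_of_neg (show v 0 < 0 from h)]

/-- Every coordinate vector `v` at `q` represents a tangent vector `w` of the space form. -/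
theorem exists_chartVel_eq {k e : ℝ} {q : Fin 4 → ℝ} (he : e ^ 2 = 1)
    (hq : q ∈ spaceForm k) (hD : 1 + e * q 0 ≠ 0) (v : Fin 3 → ℝ) :
    ∃ w : Fin 4 → ℝ, q 0 * w 0 + k * ∑ i : Fin 3, q i.succ * w i.succ = 0 ∧
      ∀ i, chartVel e q w i = v i := by
  -- This is `chart_mul_chartVel` solved for `w 0`; the spatial part then comes from inverting the
  -- formula of `chartVel`.
  set w0 : ℝ := -(e * k * (1 + e * q 0) / 2) * ∑ i : Fin 3, q i.succ * v i with hw0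
  refine ⟨event w0 fun i => (1 + e * q 0) / 2 * v i + q i.succ * e * w0 / (1 + e * q 0), ?_,
    fun i => ?_⟩
  · have h1 := hq.1
    change q 0 * w0 + k * ∑ i : Fin 3, q i.succ *
      ((1 + e * q 0) / 2 * v i + q i.succ * e * w0 / (1 + e * q 0)) = 0
    simp only [Fin.sum_univ_three] at h1 hw0 ⊢
    have hA : k * (q (Fin.succ 0) ^ 2 + q (Fin.succ 1) ^ 2 + q (Fin.succ 2) ^ 2) / (1 + e * q 0) =
        1 - e * q 0 := by
      field_simp
      linear_combination h1 + q 0 ^ 2 * he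
    linear_combination e * w0 * hA + e * hw0 - (q 0 * w0 + k * (1 + e * q 0) / 2 *
      (q (Fin.succ 0) * v 0 + q (Fin.succ 1) * v 1 + q (Fin.succ 2) * v 2)) * he
  · change 2 * ((1 + e * q 0) / 2 * v i + q i.succ * e * w0 / (1 + e * q 0)) / (1 + e * q 0) -
      2 * q i.succ * (e * w0) / (1 + e * q 0) ^ 2 = v i
    field_simp
    ring

end Universe

/-! ### Completeness of causal geodesics and the finite end time -/

namespace Universe
variable (U : Universe)

theorem normSq_rwMetric (k : ℝ) (a : ℝ → ℝ) (x v : Fin 4 → ℝ) :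
    normSq (rwMetric k a) x v =
      -v 0 ^ 2 + a (x 0) ^ 2 / phi k x ^ 2 * ∑ i : Fin 3, v i.succ ^ 2 := by
  simp only [normSq, Fin.sum_univ_succ (n := 3), rwMetric_zero_zero, rwMetric_zero_succ,
    rwMetric_succ_zero, rwMetric_succ_succ, ite_mul, zero_mul, Finset.sum_ite_eq,
    Finset.mem_univ, if_true, Finset.sum_const_zero, zero_add, add_zero, Finset.mul_sum]
  congr 1
  · ring
  · exact Finset.sum_congr rfl fun i _ => by ring

/-- A geodesic is required on some `(-δ, ∞)`, so that its velocity at `0` is a two-sided derivative.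
Openness of `I` supplies the room before `t₀`. -/
theorem exists_forall_mem {t₀ σ : ℝ} (hσ : σ ^ 2 = 1) (ht₀ : t₀ ∈ U.I)
    (hI : ∀ u, 0 ≤ u → t₀ + σ * u ∈ U.I) : ∃ η > 0, ∀ u, -η ≤ u → t₀ + σ * u ∈ U.I := by
  obtain ⟨ε, hε, hb⟩ := Metric.isOpen_iff.1 U.isOpen t₀ ht₀
  refine ⟨ε / 2, half_pos hε, fun u hu => ?_⟩
  rcases le_total 0 u with h | h
  · exact hI u h
  · apply hb
    have hσ' : |σ| = 1 := by
      rw [← Real.sqrt_sq_eq_abs, hσ, Real.sqrt_one]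
    rw [Metric.mem_ball, Real.dist_eq, add_sub_cancel_left, abs_mul, hσ', one_mul,
      abs_of_nonpos h]
    linarith

/-- The time coordinate of a causal geodesic of squared mass `m` and squared momentum `ω`, in a
universe that is unbounded in the direction of the geodesic. -/
theorem exists_time_function {t₀ σ A m ω : ℝ} (hσ : σ ^ 2 = 1) (ht₀ : t₀ ∈ U.I)
    (hI : ∀ u, 0 ≤ u → t₀ + σ * u ∈ U.I) (hA : 0 < A) (hAle : ∀ t ∈ U.I, A ≤ U.a t ^ 2)
    (hm : 0 ≤ m) (hω : 0 ≤ ω) (hmω : 0 < m + ω / U.a t₀ ^ 2) :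
    ∃ δ > 0, ∃ t τ θ : ℝ → ℝ, t 0 = t₀ ∧ θ 0 = 0 ∧ Continuous t ∧ Continuous θ ∧
      τ 0 = σ * √(m + ω / U.a t₀ ^ 2) ∧ ∀ s, -δ < s → t s ∈ U.I ∧ HasDerivAt t (τ s) s ∧
        HasDerivAt θ (1 / U.a (t s) ^ 2) s ∧
        HasDerivAt τ (-(deriv U.a (t s) * ω / U.a (t s) ^ 3)) s := by
  obtain ⟨η, hη, hmem⟩ := U.exists_forall_mem hσ ht₀ hI
  -- The scale factor is frozen before `-η`, which makes the right-hand side of the equation for `u`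
  -- defined on all of `ℝ`. Past `-δ` the solution stays above `-η`, where `b` is the true scale
  -- factor.
  set b : ℝ → ℝ := fun u => U.a (t₀ + σ * max u (-η)) with hb
  have hmem' : ∀ u, t₀ + σ * max u (-η) ∈ U.I := fun u => hmem _ (le_max_right _ _)
  have hbpos : ∀ u, 0 < b u := fun u => U.a_pos _ (hmem' u)
  have hbA : ∀ u, A ≤ b u ^ 2 := fun u => hAle _ (hmem' u)
  have hbc : Continuous b :=
    U.a_contDiff.continuousOn.comp_continuous (by fun_prop) hmem'
  have hb0 : b 0 = U.a t₀ := by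
    simp [hb, max_eq_left (neg_nonpos.2 hη.le)]
  have hpos : ∀ u, 0 < m + ω / b u ^ 2 := fun u => by
    have h1 : 0 ≤ ω / b u ^ 2 := div_nonneg hω (sq_nonneg _)
    rcases hm.lt_or_eq with h | h
    · linarith
    · rcases hω.lt_or_eq with h' | h'
      · have := div_pos h' (pow_pos (hbpos u) 2)
        linarith
      · simp [← h, ← h'] at hmω
  have hbc2 : Continuous fun u => ω / b u ^ 2 :=
    continuous_const.div (hbc.pow 2) fun u => pow_ne_zero 2 (hbpos u).ne'
  obtain ⟨u, hu0, hu⟩ := exists_global_solution (f := fun u => √(m + ω / b u ^ 2))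
    (M := √(m + ω / A)) (by fun_prop) (fun u => Real.sqrt_pos.2 (hpos u)) (fun u => by
      have := div_le_div_of_nonneg_left hω hA (hbA u)
      exact Real.sqrt_le_sqrt (by linarith))
  have huc : Continuous u := continuous_iff_continuousAt.2 fun s => (hu s).continuousAt
  have humono : StrictMono u := strictMono_of_deriv_pos fun s => by
    rw [(hu s).deriv]; exact Real.sqrt_pos.2 (hpos _)
  obtain ⟨δ, hδ, hδu⟩ : ∃ δ > 0, -η < u (-δ) := by
    have h1 : ∀ᶠ s in 𝓝 0, -η < u s :=
      huc.continuousAt.eventually (by rw [hu0]; exact lt_mem_nhds (neg_lt_zero.2 hη))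
    obtain ⟨ε, hε, hball⟩ := Metric.eventually_nhds_iff.1 h1
    refine ⟨ε / 2, half_pos hε, hball ?_⟩
    rw [Real.dist_eq, sub_zero, abs_neg, abs_of_pos (half_pos hε)]
    linarith
  have hbinv : Continuous fun s => 1 / b (u s) ^ 2 :=
    continuous_const.div ((hbc.comp huc).pow 2) fun s => pow_ne_zero 2 (hbpos _).ne'
  have hbt : ∀ s, -δ < s → b (u s) = U.a (t₀ + σ * u s) := fun s hs => by
    have := hδu.trans (humono hs)
    simp [hb, max_eq_left this.le]
  refine ⟨δ, hδ, fun s => t₀ + σ * u s, fun s => σ * √(m + ω / b (u s) ^ 2),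
    fun s => ∫ r in (0 : ℝ)..s, 1 / b (u r) ^ 2, by simp [hu0], by simp,
    by fun_prop, ?_, by simp only [hu0, hb0], fun s hs => ?_⟩
  · exact continuous_iff_continuousAt.2 fun s =>
      (intervalIntegral.integral_hasDerivAt_right (hbinv.intervalIntegrable 0 s)
        (hbinv.stronglyMeasurableAtFilter _ _) hbinv.continuousAt).continuousAt
  have htI : t₀ + σ * u s ∈ U.I := hmem _ (hδu.trans (humono hs)).le
  have ht : HasDerivAt (fun s => t₀ + σ * u s) (σ * √(m + ω / b (u s) ^ 2)) s :=
    ((hu s).const_mul σ).const_add t₀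
  refine ⟨htI, ht, ?_, ?_⟩
  · rw [← hbt s hs]
    exact intervalIntegral.integral_hasDerivAt_right (hbinv.intervalIntegrable 0 s)
      (hbinv.stronglyMeasurableAtFilter _ _) hbinv.continuousAt
  · have ha := (U.twiceDiff htI).deriv_one.self_of_nhds
    have ha0 := (U.a_pos _ htI).ne'
    have hp := hpos (u s)
    rw [hbt s hs] at hp ht
    have hsq : √(m + ω / U.a (t₀ + σ * u s) ^ 2) ≠ 0 := (Real.sqrt_pos.2 hp).ne'
    refine HasDerivAt.congr_of_eventuallyEq (f₁ := fun s => σ * √(m + ω / b (u s) ^ 2))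
      (f := fun s => σ * √(m + ω / U.a (t₀ + σ * u s) ^ 2)) ?_ ?_
    -- The root in the denominator of the derivative cancels against `t' = σ √(…)`, leaving `σ² =
    -- 1`.
    · refine (((((hasDerivAt_const s ω).fun_div ((ha.comp s ht).fun_pow 2)
        (pow_ne_zero 2 ha0)).const_add m).sqrt hp.ne').const_mul σ).congr_deriv ?_
      simp only [Function.comp]
      generalize √(m + ω / U.a (t₀ + σ * u s) ^ 2) = z at *
      push_cast
      field_simp
      linear_combination -(2 * ω * deriv U.a (t₀ + σ * u s) * z) * hσ
    · filter_upwards [lt_mem_nhds hs] with r hr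
      rw [hbt r hr]

/-- If the universe is unbounded in a time direction, then every causal geodesic pointing in this
direction is complete. -/
theorem geodesicComplete {A : ℝ} (hA : 0 < A) (hAle : ∀ t ∈ U.I, A ≤ U.a t ^ 2) {d : Direction}
    (hI : ∀ t₀ ∈ U.I, ∀ u, 0 ≤ u → t₀ + d.sign * u ∈ U.I) {e : ℝ} (he : IsChart U.k e)
    {P : ℝ × (Fin 4 → ℝ)} (hP : P.1 ∈ U.I) (hPs : P.2 ∈ spaceForm U.k)
    (hPe : P.2 ∈ chartDomain e) {v : Fin 4 → ℝ} (hv : IsDirected v d)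
    (hn : normSq U.metric (chart e P) v ≤ 0) : U.GeodesicComplete e P v := by
  obtain ⟨t₀, q⟩ := P
  simp only at hP hPs hPe
  have hD : 1 + e * q 0 ≠ 0 := hPe
  have ha0 := U.a_pos t₀ hP
  -- The factor `a²` compensates `θ' = 1/a²`: `w` is the velocity with respect to `θ`, not `s`.
  obtain ⟨w, hw, hwv⟩ := exists_chartVel_eq he.sq_eq hPs hD fun i => U.a t₀ ^ 2 * v i.succ
  set ω := U.k * w 0 ^ 2 + ∑ i : Fin 3, w i.succ ^ 2 with hω
  obtain ⟨Q, V, hQ0, hV0, hQ⟩ := exists_spaceGeodesic U.k_mem hPs hw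
  rw [← hω] at hQ
  have hspeed := sum_chartVel_sq U.k_mem he.sq_eq hPs hD hw hω.symm
  simp only [hwv] at hspeed
  -- For `k = -1` the sign of `ω` is not visible from its definition; it follows from the sum of
  -- squares in the chart.
  have hω0 : 0 ≤ ω := by
    have h1 : 0 ≤ 4 * ω / (1 + e * q 0) ^ 2 := by
      rw [← hspeed]; exact Finset.sum_nonneg fun i _ => sq_nonneg _
    have h2 : 0 < (1 + e * q 0) ^ 2 := by positivity
    rw [le_div_iff₀ h2] at h1
    linarith
  have hφ : phi U.k (chart e (t₀, q)) = 2 / (1 + e * q 0) := conformal_chart he.sq_eq hPs hD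
  have hx0 : chart e (t₀, q) 0 = t₀ := rfl
  have hnorm : normSq U.metric (chart e (t₀, q)) v = -v 0 ^ 2 + ω / U.a t₀ ^ 2 := by
    rw [metric, normSq_rwMetric, hφ, hx0]
    simp only [mul_pow, ← Finset.mul_sum] at hspeed
    congr 1
    rw [eq_div_iff (pow_ne_zero 2 ha0.ne')]
    have h4 : ω = (1 + e * q 0) ^ 2 / 4 * ((U.a t₀ ^ 2) ^ 2 * ∑ i : Fin 3, v i.succ ^ 2) := by
      rw [hspeed]; field_simp
    rw [h4]
    field_simp
    ring
  have hv0 : v 0 ≠ 0 := by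
    cases d
    · exact ne_of_gt hv
    · exact ne_of_lt hv
  -- Here `m = -g(v, v)`, nonnegative because `v` is causal. With this choice `m + ω/a² = (v 0)²` at
  -- the start, so the initial time velocity is `v 0`.
  obtain ⟨δ, hδ, t, τ, θ, ht0, hθ0, htc, hθc, hτ0, h⟩ := U.exists_time_function
    (m := v 0 ^ 2 - ω / U.a t₀ ^ 2) d.sign_sq hP (hI t₀ hP) hA hAle (by linarith) hω0
    (by rw [sub_add_cancel]; positivity)
  rw [sub_add_cancel, Real.sqrt_sq_eq_abs, sign_mul_abs hv] at hτ0
  refine ⟨δ, hδ, fun s => (t s, Q (θ s)), ⟨?_, fun s hs => ⟨(h s hs).1, hQ.mem _,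
    fun e' he' hD' => ?_⟩⟩, by simp [ht0, hθ0, hQ0], ?_⟩
  · refine (htc.prodMk ?_).continuousOn
    refine continuous_pi fun i => ?_
    exact (continuous_iff_continuousAt.2 fun r => (hQ.deriv_pos r i).continuousAt).comp hθc
  · have hnh : ∀ᶠ r in 𝓝 s, -δ < r := lt_mem_nhds hs
    exact geodesicEqAt_chart U.k_mem he'.sq_eq hQ hD'
      (hnh.mono fun r hr => (U.a_pos _ (h r hr).1).ne') (hnh.mono fun r hr => (h r hr).2.1)
      (hnh.mono fun r hr => (h r hr).2.2.1) (h s hs).2.2.2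
      (U.twiceDiff (h s hs).1).deriv_one.self_of_nhds
  · rw [hasDerivAt_pi]
    have h0 := h 0 (neg_lt_zero.2 hδ)
    intro i
    refine Fin.cases ?_ (fun j => ?_) i
    · rw [← hτ0]
      exact h0.2.1
    · have hc := (hQ.hasDerivAt_chart (e := e) (θ := θ 0) (by rw [hθ0, hQ0]; exact hD) j).comp 0
        h0.2.2.1
      refine hc.congr_deriv ?_
      rw [hθ0, hQ0, hV0, hwv, ht0]
      field_simp

/-- An interval without a finite end in the direction `d` contains every half-line issuing from its
points in that direction, and `geodesicComplete` then contradicts the incompleteness. -/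
theorem IsEndTime.exists {A : ℝ} (hA : 0 < A) (hAle : ∀ t ∈ U.I, A ≤ U.a t ^ 2) {d : Direction}
    (hinc : U.NullIncomplete d ∨ U.TimelikeIncomplete d) : ∃ ts, U.IsEndTime ts d := by
  by_contra! hno
  have hI : ∀ t₀ ∈ U.I, ∀ u, 0 ≤ u → t₀ + d.sign * u ∈ U.I := by
    intro t₀ ht₀ u hu
    cases d
    · have hb : ¬ BddAbove U.I := fun hb => hno _ (isLUB_csSup U.nonempty hb)
      obtain ⟨z, hz, hlt⟩ := not_bddAbove_iff.1 hb (t₀ + u)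
      simp only [Direction.sign, one_mul]
      exact U.ordConnected.out ht₀ hz ⟨by linarith, hlt.le⟩
    · have hb : ¬ BddBelow U.I := fun hb => hno _ (isGLB_csInf U.nonempty hb)
      obtain ⟨z, hz, hlt⟩ := not_bddBelow_iff.1 hb (t₀ - u)
      simp only [Direction.sign]
      exact U.ordConnected.out hz ht₀ ⟨by linarith, by linarith⟩
  rcases hinc with ⟨e, he, P, hP, hPs, hPe, v, hv, hn, hc⟩ | ⟨e, he, P, hP, hPs, hPe, v, hv, hn, hc⟩
  · exact hc (U.geodesicComplete hA hAle hI he hP hPs hPe hv hn.le)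
  · exact hc (U.geodesicComplete hA hAle hI he hP hPs hPe hv hn.le)

end Universe

/-! ### Behaviours at the end of time -/

/-- `f` is bounded above by a positive affine function of `g` along `l`. -/
def LeAffine (l : Filter ℝ) (f g : ℝ → ℝ) : Prop :=
  ∃ c > 0, ∃ C : ℝ, ∀ᶠ t in l, f t ≤ c * g t + C

section
variable {l : Filter ℝ} {f g : ℝ → ℝ}

theorem LeAffine.staysFinite (h : LeAffine l f g) (hg : StaysFinite l g) : StaysFinite l f := by
  obtain ⟨c, hc, C, h⟩ := h
  obtain ⟨B, hB⟩ := hg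
  refine ⟨c * B + C, ?_⟩
  filter_upwards [h, hB] with t h1 h2
  have := mul_le_mul_of_nonneg_left h2 hc.le
  linarith

/-- Holding in both readings, this lets the equivalences of the theorem be proved uniformly in `r`.
-/
theorem LeAffine.diverges (h : LeAffine l f g) {r : Reading} (hf : Diverges l f r) :
    Diverges l g r := by
  cases r
  · exact fun hg => hf (h.staysFinite hg)
  · obtain ⟨c, hc, C, h⟩ := h
    have h1 : Tendsto (fun t => c * g t + C) l atTop := tendsto_atTop_mono' _ h hf
    have h2 := (tendsto_atTop_add_const_right l (-C) h1).const_mul_atTop (inv_pos.2 hc)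
    refine h2.congr fun t => ?_
    field_simp
    ring

theorem staysFinite_congr (h₁ : LeAffine l f g) (h₂ : LeAffine l g f) :
    StaysFinite l f ↔ StaysFinite l g :=
  ⟨h₂.staysFinite, h₁.staysFinite⟩

theorem diverges_congr (h₁ : LeAffine l f g) (h₂ : LeAffine l g f) (r : Reading) :
    Diverges l f r ↔ Diverges l g r :=
  ⟨h₁.diverges, h₂.diverges⟩

/-- A limit other than `⊤` lies below some real number, which eventually bounds `f` above; the limit
`⊥` counts as finite. -/
theorem HasLimit.diverges_or_staysFinite (h : HasLimit l f) :
    Diverges l f .limit ∨ StaysFinite l f := by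
  obtain ⟨L, hL⟩ := h
  by_cases htop : L = ⊤
  · left
    rw [htop] at hL
    exact EReal.tendsto_coe_nhds_top_iff.1 hL
  · right
    obtain ⟨C, hC, -⟩ := EReal.lt_iff_exists_real_btwn.1 (lt_top_iff_ne_top.2 htop)
    refine ⟨C, ?_⟩
    filter_upwards [hL.eventually (gt_mem_nhds hC)] with t ht
    exact (EReal.coe_lt_coe_iff.1 ht).le

theorem someB_unbounded (l : Filter ℝ) (f g : ℝ → ℝ) : SomeB .unbounded l f g := by
  by_cases hf : StaysFinite l f <;> by_cases hg : StaysFinite l g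
  · exact .inr (.inr (.inr ⟨hf, hg⟩))
  · exact .inr (.inl ⟨hf, hg⟩)
  · exact .inr (.inr (.inl ⟨hf, hg⟩))
  · exact .inl ⟨hf, hg⟩

theorem HasLimit.someB (hf : HasLimit l f) (hg : HasLimit l g) : SomeB .limit l f g := by
  rcases hf.diverges_or_staysFinite with hf | hf <;>
    rcases hg.diverges_or_staysFinite with hg | hg
  · exact .inl ⟨hf, hg⟩
  · exact .inr (.inr (.inl ⟨hf, hg⟩))
  · exact .inr (.inl ⟨hf, hg⟩)
  · exact .inr (.inr (.inr ⟨hf, hg⟩))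

end

end FRW
end

/-! ### Comparison of the curvature norms with density and pressure -/

theorem theorem6 (U : FRW.Universe) (hreg : U.RegularlyHyperbolic)
    (κ : ℝ) (hκ : 0 < κ) (μ p : ℝ → ℝ) (hfluid : U.IsFluid κ μ p)
    (d : FRW.Direction) (hinc : U.NullIncomplete d ∨ U.TimelikeIncomplete d) :
    ∃ ts : ℝ, U.IsEndTime ts d ∧ ∀ y ∈ FRW.spatialCoords U.k,
      FRW.SomeB .unbounded (𝓝[U.I] ts) (U.normE y) (U.normD y) ∧
      (FRW.HasLimit (𝓝[U.I] ts) (U.normE y) → FRW.HasLimit (𝓝[U.I] ts) (U.normD y) →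
        FRW.SomeB .limit (𝓝[U.I] ts) (U.normE y) (U.normD y)) ∧
      ∀ r : FRW.Reading,
        (FRW.B1 r (𝓝[U.I] ts) (U.normE y) (U.normD y) ↔
          FRW.Diverges (𝓝[U.I] ts) μ r ∧
            FRW.Diverges (𝓝[U.I] ts) (fun t => |μ t + 3 * p t|) r) ∧
        (FRW.B2 r (𝓝[U.I] ts) (U.normE y) (U.normD y) ↔
          FRW.Diverges (𝓝[U.I] ts) μ r ∧
            FRW.StaysFinite (𝓝[U.I] ts) (fun t => |μ t + 3 * p t|)) ∧
        (FRW.B3 r (𝓝[U.I] ts) (U.normE y) (U.normD y) ↔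
          FRW.StaysFinite (𝓝[U.I] ts) μ ∧
            FRW.Diverges (𝓝[U.I] ts) (fun t => |μ t + 3 * p t|) r) ∧
        (FRW.B3 r (𝓝[U.I] ts) (U.normE y) (U.normD y) ↔
          FRW.StaysFinite (𝓝[U.I] ts) μ ∧
            FRW.Diverges (𝓝[U.I] ts) (fun t => |p t|) r) ∧
        (FRW.B4 (𝓝[U.I] ts) (U.normE y) (U.normD y) ↔
          FRW.StaysFinite (𝓝[U.I] ts) μ ∧
            FRW.StaysFinite (𝓝[U.I] ts) (fun t => |μ t + 3 * p t|)) ∧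
        (FRW.B4 (𝓝[U.I] ts) (U.normE y) (U.normD y) ↔
          FRW.StaysFinite (𝓝[U.I] ts) μ ∧
            FRW.StaysFinite (𝓝[U.I] ts) (fun t => |p t|)) := by
  obtain ⟨A, hA, hAle⟩ := hreg.exists_le
  obtain ⟨ts, hts⟩ := FRW.Universe.IsEndTime.exists U hA hAle hinc
  refine ⟨ts, hts, fun y hy => ?_⟩
  set l := 𝓝[U.I] ts
  have hI : ∀ᶠ t in l, t ∈ U.I := self_mem_nhdsWithin
  have h3 : 0 < √(3 : ℝ) := Real.sqrt_pos.2 (by norm_num)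
  have hE : ∀ t ∈ U.I, U.normE y t = √3 * κ / 6 * |μ t + 3 * p t| := fun t ht => by
    have h6 := hfluid.acceleration ht
    have : deriv (deriv U.a) t / U.a t = -(κ / 6) * (μ t + 3 * p t) := by linarith
    rw [U.normE_eq hy ht, this, abs_mul, abs_neg, abs_of_pos (by positivity)]
    ring
  have hD : ∀ t ∈ U.I, U.normD y t = √3 * κ / 3 * |μ t| := fun t ht => by
    have h6 := hfluid.density ht
    have : (deriv U.a t ^ 2 + U.k) / U.a t ^ 2 = κ / 3 * μ t := by linarith
    rw [U.normD_eq hy ht, this, abs_mul, abs_of_pos (by positivity)]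
    ring
  have hk : -1 ≤ U.k := by rcases U.k_mem with h | h | h <;> rw [h] <;> norm_num
  -- From `a'² ≥ 0`, `k ≥ -1` and `a² ≥ A` one has `(a'² + k)/a² ≥ -1/A`; multiplying by `3/κ` gives
  -- the bound.
  have hμ : ∀ t ∈ U.I, -(3 / (κ * A)) ≤ μ t := fun t ht => by
    have hK : -(1 / A) ≤ (deriv U.a t ^ 2 + U.k) / U.a t ^ 2 := by
      have h1 : 0 < U.a t ^ 2 := hA.trans_le (hAle t ht)
      rw [le_div_iff₀ h1]
      have h2 : 1 ≤ 1 / A * U.a t ^ 2 := by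
        rw [one_div_mul_eq_div, le_div_iff₀ hA, one_mul]; exact hAle t ht
      nlinarith [sq_nonneg (deriv U.a t)]
    have h6 := hfluid.density ht
    have : -(3 / (κ * A)) * κ ≤ μ t * κ := by
      have h7 : -(3 / (κ * A)) * κ = 3 * -(1 / A) := by field_simp
      linarith
    exact le_of_mul_le_mul_right this hκ
  have hEle : FRW.LeAffine l (U.normE y) fun t => |μ t + 3 * p t| :=
    ⟨√3 * κ / 6, by positivity, 0, hI.mono fun t ht => by rw [hE t ht, add_zero]⟩
  have hleE : FRW.LeAffine l (fun t => |μ t + 3 * p t|) (U.normE y) :=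
    ⟨(√3 * κ / 6)⁻¹, by positivity, 0, hI.mono fun t ht => by
      rw [hE t ht, add_zero, inv_mul_cancel_left₀ (by positivity)]⟩
  -- With `c = 3/(κA)` and `μ ≥ -c`, one has `|μ| ≤ μ + 2c`.
  have hDle : FRW.LeAffine l (U.normD y) μ :=
    ⟨√3 * κ / 3, by positivity, √3 * κ / 3 * (2 * (3 / (κ * A))), hI.mono fun t ht => by
      rw [hD t ht, ← mul_add]
      refine mul_le_mul_of_nonneg_left (abs_le.2 ⟨?_, ?_⟩) (by positivity)
      · linarith [hμ t ht]
      · have : 0 < 3 / (κ * A) := by positivity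
        linarith⟩
  have hleD : FRW.LeAffine l μ (U.normD y) :=
    ⟨(√3 * κ / 3)⁻¹, by positivity, 0, hI.mono fun t ht => by
      rw [hD t ht, add_zero, inv_mul_cancel_left₀ (by positivity)]
      exact le_abs_self _⟩
  have habs : FRW.StaysFinite l μ → ∃ M, ∀ᶠ t in l, |μ t| ≤ M := fun ⟨C, hC⟩ => by
    refine ⟨max C (3 / (κ * A)), ?_⟩
    filter_upwards [hC, hI] with t h1 h2
    exact abs_le.2 ⟨(neg_le_neg (le_max_right _ _)).trans (hμ t h2), h1.trans (le_max_left _ _)⟩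
  have hple : FRW.StaysFinite l μ →
      FRW.LeAffine l (fun t => |p t|) (fun t => |μ t + 3 * p t|) := fun h => by
    obtain ⟨M, hM⟩ := habs h
    refine ⟨1 / 3, by norm_num, M / 3, hM.mono fun t ht => ?_⟩
    have h1 := abs_sub (μ t + 3 * p t) (μ t)
    rw [add_sub_cancel_left, abs_mul, abs_of_pos (by norm_num : (0 : ℝ) < 3)] at h1
    linarith
  have hlep : FRW.StaysFinite l μ →
      FRW.LeAffine l (fun t => |μ t + 3 * p t|) (fun t => |p t|) := fun h => by
    obtain ⟨M, hM⟩ := habs h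
    refine ⟨3, by norm_num, M, hM.mono fun t ht => ?_⟩
    have h1 := abs_add_le (μ t) (3 * p t)
    rw [abs_mul 3, abs_of_pos (by norm_num : (0 : ℝ) < 3)] at h1
    linarith
  have sE := FRW.staysFinite_congr hEle hleE
  have sD := FRW.staysFinite_congr hDle hleD
  have dE := FRW.diverges_congr hEle hleE
  have dD := FRW.diverges_congr hDle hleD
  refine ⟨FRW.someB_unbounded _ _ _, fun lE lD => lE.someB lD, fun r => ⟨?_, ?_, ?_, ?_, ?_, ?_⟩⟩
  · rw [FRW.B1, dE r, dD r, and_comm]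
  · rw [FRW.B2, sE, dD r, and_comm]
  · rw [FRW.B3, dE r, sD, and_comm]
  · rw [FRW.B3, dE r, sD, and_comm]
    -- `|p|` and `|μ + 3p|` are comparable only when `μ` stays finite, so the second factor is
    -- compared under the first.
    exact and_congr_right fun h => FRW.diverges_congr (hlep h) (hple h) r
  · rw [FRW.B4, sE, sD, and_comm]
  · rw [FRW.B4, sE, sD, and_comm]
    exact and_congr_right fun h => FRW.staysFinite_congr (hlep h) (hple h)
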